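/- Let ${\bf k}$ be a field of characteristic $0$ and let $(\mathfrak g,[\,,],\alpha)$ be a multiplicative Hom-Lie algebra over ${\bf k}$: a vector space with a skew-symmetric bilinear bracket and a linear map $\alpha$ such that $[\alpha x,[y,z]]+[\alpha y,[z,x]]+[\alpha z,[x,y]]=0$ and $\alpha[x,y]=[\alpha x,\alpha y]$ for all $x,y,z\in\mathfrak g$. For $n\ge 1$ let $C^n_{\mathrm{Hom}}(\mathfrak g,\mathfrak g)$ be the space of alternating $n$-linear maps $f:\mathfrak g^n\to\mathfrak g$ with $\alpha(f(x_1,\dots,x_n))=f(\alpha x_1,\dots,\alpha x_n)$, and let $C^\bullet_{\mathrm{Hom}}(\mathfrak g,\mathfrak g)=\bigoplus_{n\ge1}C^n_{\mathrm{Hom}}(\mathfrak g,\mathfrak g)$. Write $Sh(p,q)$ for the permutations of $\{1,\dots,p+q\}$ that are increasing on $1,\dots,p$ and on $p+1,\dots,p+q$. For $P\in C^m_{\mathrm{Hom}}(\mathfrak g,\mathfrak g)$ and $Q\in C^n_{\mathrm{Hom}}(\mathfrak g,\mathfrak g)$ put $$(i_PQ)(x_1,\dots,x_{m+n-1})=\sum_{\sigma\in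 Sh(m,n-1)}(-1)^\sigma\, Q\big(P(x_{\sigma(1)},\dots,x_{\sigma(m)}),\alpha^{m-1}x_{\sigma(m+1)},\dots,\alpha^{m-1}x_{\sigma(m+n-1)}\big),$$ $$[P,Q]_{\mathsf C}(x_1,\dots,x_{m+n})=\sum_{\sigma\in Sh(m,n)}(-1)^\sigma\,\big[\alpha^{n-1}P(x_{\sigma(1)},\dots,x_{\sigma(m)}),\alpha^{m-1}Q(x_{\sigma(m+1)},\dots,x_{\sigma(m+n)})\big],$$ $$(\delta_{\mathrm{Hom}}P)(x_1,\dots,x_{m+1})=\sum_{i=1}^{m+1}(-1)^{i+1}[\alpha^{m-1}x_i,P(x_1,\dots,\widehat{x_i},\dots,x_{m+1})]+\sum_{i<j}(-1)^{i+j}P([x_i,x_j],\alpha x_1,\dots,\widehat{\alpha x_i},\dots,\widehat{\alpha x_j},\dots,\alpha x_{m+1}),$$ $$[P,Q]_{\mathsf{NR}}=i_PQ-(-1)^{(m-1)(n-1)}i_QP,\qquad [P,Q]_{\mathsf{FN}}=[P,Q]_{\mathsf C}+(-1)^m i_{(\delta_{\mathrm{Hom}}P)}Q-(-1)^{(m+1)n}i_{(\delta_{\mathrm{Hom}}Q)}P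 .$$ A graded Lie algebra is a $\mathbb Z$-graded vector space with a bilinear bracket of degree $0$ that satisfies $[x,y]=-(-1)^{|x||y|}[y,x]$ and $[x,[y,z]]=[[x,y],z]+(-1)^{|x||y|}[y,[x,z]]$ for homogeneous $x,y,z$. Then: (i) $(C^\bullet_{\mathrm{Hom}}(\mathfrak g,\mathfrak g),[\,,]_{\mathsf{FN}})$, with $C^n_{\mathrm{Hom}}(\mathfrak g,\mathfrak g)$ in degree $n$, is a graded Lie algebra (the Frölicher-Nijenhuis algebra). (ii) $(C^{\bullet+1}_{\mathrm{Hom}}(\mathfrak g,\mathfrak g),[\,,]_{\mathsf{NR}})$, with $C^{n+1}_{\mathrm{Hom}}(\mathfrak g,\mathfrak g)$ in degree $n$, is a graded Lie algebra (the Nijenhuis-Richardson algebra), and $\delta_{\mathrm{Hom}}:C^\bullet_{\mathrm{Hom}}(\mathfrak g,\mathfrak g)\to C^{\bullet+1}_{\mathrm{Hom}}(\mathfrak g,\mathfrak g)$ is a morphism of graded Lie algebras from the Frölicher-Nijenhuis algebra to the Nijenhuis-Richardson algebra: it is linear of degree $0$ and $\delta_{\mathrm{Hom}}[P,Q]_{\mathsf{FN}}=[\delta_{\mathrm{Hom}}P,\delta_{\mathrm{Hom}}Q]_{\mathsf{NR}}$.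 -/

import Mathlib

open scoped DirectSum

noncomputable section

/-! ### Graded Lie algebras -/

/-- `(L, br)`, graded by the submodules `𝒜 i` (`i : ℤ`), is a graded Lie algebra: `L` is the
internal direct sum of the `𝒜 i`, the bracket has degree `0`, is graded skew-symmetric and
satisfies the graded Jacobi identity. -/
structure IsGradedLieAlgebra {K L : Type*} [Field K] [AddCommGroup L] [Module K L]
    (𝒜 : ℤ → Submodule K L) (br : L →ₗ[K] L →ₗ[K] L) : Prop where
  isInternal : DirectSum.IsInternal 𝒜
  bracket_mem : ∀ {i j : ℤ} {x y : L}, x ∈ 𝒜 i → y ∈ 𝒜 j → br x y ∈ 𝒜 (i + j)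
  skew : ∀ {i j : ℤ} {x y : L}, x ∈ 𝒜 i → y ∈ 𝒜 j →
    br x y = -((i * j).negOnePow • br y x)
  jacobi : ∀ {i j k : ℤ} {x y z : L}, x ∈ 𝒜 i → y ∈ 𝒜 j → z ∈ 𝒜 k →
    br x (br y z) = br (br x y) z + (i * j).negOnePow • br y (br x z)

/-- A morphism of graded Lie algebras: a linear map of degree `0` that preserves the brackets. -/
structure IsGradedLieHom {K L L' : Type*} [Field K] [AddCommGroup L] [Module K L]
    [AddCommGroup L'] [Module K L'] (𝒜 : ℤ → Submodule K L) (br : L →ₗ[K] L →ₗ[K] L)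
    (ℬ : ℤ → Submodule K L') (br' : L' →ₗ[K] L' →ₗ[K] L') (φ : L →ₗ[K] L') : Prop where
  map_mem : ∀ {i : ℤ} {x : L}, x ∈ 𝒜 i → φ x ∈ ℬ i
  map_bracket : ∀ x y : L, φ (br x y) = br' (φ x) (φ y)

/-! ### Hom-Lie algebras -/

/-- A Hom-Lie algebra structure on the vector space `g`. -/
structure HomLieAlgebra (K g : Type*) [Field K] [AddCommGroup g] [Module K g] where
  bracket : g →ₗ[K] g →ₗ[K] g
  twist : g →ₗ[K] g
  skew : ∀ x y, bracket x y = -bracket y x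
  hom_jacobi : ∀ x y z, bracket (twist x) (bracket y z) + bracket (twist y) (bracket z x)
    + bracket (twist z) (bracket x y) = 0

/-- A multiplicative Hom-Lie algebra: the twist map preserves the bracket. -/
structure MultHomLieAlgebra (K g : Type*) [Field K] [AddCommGroup g] [Module K g] extends
    HomLieAlgebra K g where
  map_bracket : ∀ x y, twist (bracket x y) = bracket (twist x) (twist y)

/-! ### Shuffles -/

/-- The `(p, q)`-shuffles: permutations that are increasing on the first `p` and on the last `q`
indices. -/
def shuffles (p q : ℕ) : Finset (Equiv.Perm (Fin (p + q))) :=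
  open Classical in
  Finset.univ.filter fun σ =>
    StrictMono (fun i : Fin p => σ (Fin.castAdd q i)) ∧
      StrictMono (fun j : Fin q => σ (Fin.natAdd p j))

section Helpers

variable {K M N N₁ N₂ : Type*} [Field K] [AddCommGroup M] [Module K M] [AddCommGroup N]
  [Module K N] [AddCommGroup N₁] [Module K N₁] [AddCommGroup N₂] [Module K N₂]

theorem mem_shuffles {p q : ℕ} {σ : Equiv.Perm (Fin (p + q))} :
    σ ∈ shuffles p q ↔ StrictMono (fun i : Fin p => σ (Fin.castAdd q i)) ∧
      StrictMono (fun j : Fin q => σ (Fin.natAdd p j)) := by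
  classical
  simp [shuffles]

/-- A function that agrees with an alternating map, as an alternating map. -/
def altOfEq {ι : Type*} (F : (ι → M) → N)
    (h : ∃ A : M [⋀^ι]→ₗ[K] N, ∀ x, F x = A x) : M [⋀^ι]→ₗ[K] N where
  toFun := F
  map_update_add' x i a b := by
    obtain ⟨A, hA⟩ := h
    simp [hA]
  map_update_smul' x i c a := by
    obtain ⟨A, hA⟩ := h
    simp [hA]
  map_eq_zero_of_eq' x i j hx hij := by
    obtain ⟨A, hA⟩ := h
    rw [hA]
    exact A.map_eq_zero_of_eq x hx hij

@[simp] theorem altOfEq_apply {ι : Type*} (F : (ι → M) → N)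
    (h : ∃ A : M [⋀^ι]→ₗ[K] N, ∀ x, F x = A x) (x : ι → M) : altOfEq F h x = F x := rfl

/-- The shuffle sum of alternating maps is alternating. -/
theorem exists_shuffleSum {p q : ℕ} (P : M [⋀^Fin p]→ₗ[K] N₁)
    (G : N₁ →ₗ[K] M [⋀^Fin q]→ₗ[K] N) :
    ∃ A : M [⋀^Fin (p + q)]→ₗ[K] N, ∀ x : Fin (p + q) → M,
      ∑ σ ∈ shuffles p q, Equiv.Perm.sign σ •
        G (P fun i => x (σ (Fin.castAdd q i))) (fun j => x (σ (Fin.natAdd p j))) = A x := by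
  classical
  let ev : M [⋀^Fin q]→ₗ[K] ((M [⋀^Fin q]→ₗ[K] N) →ₗ[K] N) :=
    { toFun := fun y =>
        { toFun := fun φ => φ y
          map_add' := fun _ _ => rfl
          map_smul' := fun _ _ => rfl }
      map_update_add' := fun y i a b => by
        ext φ
        simp
      map_update_smul' := fun y i c a => by
        ext φ
        simp
      map_eq_zero_of_eq' := fun y i j hy hij => by
        ext φ
        exact φ.map_eq_zero_of_eq y hy hij }
  let ℓ : TensorProduct K N₁ ((M [⋀^Fin q]→ₗ[K] N) →ₗ[K] N) →ₗ[K] N :=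
    TensorProduct.lift (LinearMap.mk₂ K (fun v ψ => ψ (G v)) (by simp) (by simp) (by simp)
      (by simp))
  refine ⟨(ℓ.compAlternatingMap (P.domCoprod ev)).domDomCongr finSumFinEquiv, fun x => ?_⟩
  have key : ∀ c : Equiv.Perm (Fin p ⊕ Fin q), ∀ y : Fin p ⊕ Fin q → M,
      ℓ (AlternatingMap.domCoprod.summand P ev (Quotient.mk'' c) y) =
        Equiv.Perm.sign c •
          G (P fun i => y (c (Sum.inl i))) (fun j => y (c (Sum.inr j))) := by
    intro c y
    rw [AlternatingMap.domCoprod.summand_mk'']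
    change ℓ (Equiv.Perm.sign c • (P.toMultilinearMap.domCoprod ev.toMultilinearMap)
      (fun s => y (c s))) = _
    rw [Units.smul_def, Units.smul_def, map_zsmul]
    rfl
  have hsum : ∀ y : Fin p ⊕ Fin q → M, ℓ (P.domCoprod ev y) =
      ∑ c : Equiv.Perm.ModSumCongr (Fin p) (Fin q),
        ℓ (AlternatingMap.domCoprod.summand P ev c y) := by
    intro y
    rw [← map_sum]
    congr 1
    simp
  rw [AlternatingMap.domDomCongr_apply, LinearMap.compAlternatingMap_apply, hsum]
  refine Finset.sum_bij
    (fun σ _ => (Quotient.mk'' (finSumFinEquiv.symm.permCongr σ) :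
      Equiv.Perm.ModSumCongr (Fin p) (Fin q))) (fun _ _ => Finset.mem_univ _) ?_ ?_ ?_
  · intro σ hσ τ hτ h
    rw [mem_shuffles] at hσ hτ
    obtain ⟨⟨a, b⟩, hab⟩ := QuotientGroup.leftRel_apply.mp (Quotient.eq''.mp h)
    have hτσ : ∀ s, finSumFinEquiv.symm.permCongr τ s =
        finSumFinEquiv.symm.permCongr σ (Equiv.Perm.sumCongr a b s) := by
      intro s
      have := congrArg (fun e => (finSumFinEquiv.symm.permCongr σ) (e s)) hab
      simpa using this.symm
    have h1 : (fun i : Fin p => τ (Fin.castAdd q i)) = fun i => σ (Fin.castAdd q i) := by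
      refine (StrictMono.range_inj hτ.1 hσ.1).mp ?_
      have : (fun i : Fin p => τ (Fin.castAdd q i)) = (fun i => σ (Fin.castAdd q i)) ∘ a := by
        funext i
        have := hτσ (Sum.inl i)
        simpa [Equiv.permCongr_apply] using this
      rw [this, a.surjective.range_comp]
    have h2 : (fun j : Fin q => τ (Fin.natAdd p j)) = fun j => σ (Fin.natAdd p j) := by
      refine (StrictMono.range_inj hτ.2 hσ.2).mp ?_
      have : (fun j : Fin q => τ (Fin.natAdd p j)) = (fun j => σ (Fin.natAdd p j)) ∘ b := by
        funext j
        have := hτσ (Sum.inr j)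
        simpa [Equiv.permCongr_apply] using this
      rw [this, b.surjective.range_comp]
    ext k
    refine Fin.addCases (fun i => ?_) (fun j => ?_) k
    · exact congrArg Fin.val (congrFun h1 i).symm
    · exact congrArg Fin.val (congrFun h2 j).symm
  · intro c _
    induction c using Quotient.inductionOn' with
    | h c =>
      let f₁ : Fin p → Fin (p + q) := fun i => finSumFinEquiv (c (Sum.inl i))
      let f₂ : Fin q → Fin (p + q) := fun j => finSumFinEquiv (c (Sum.inr j))
      have i₁ : Function.Injective f₁ :=
        finSumFinEquiv.injective.comp (c.injective.comp Sum.inl_injective)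
      have i₂ : Function.Injective f₂ :=
        finSumFinEquiv.injective.comp (c.injective.comp Sum.inr_injective)
      refine ⟨finSumFinEquiv.permCongr
        (c * Equiv.Perm.sumCongr (Tuple.sort f₁) (Tuple.sort f₂)), ?_, ?_⟩
      · rw [mem_shuffles]
        constructor
        · have := (Tuple.monotone_sort f₁).strictMono_of_injective
            (i₁.comp (Tuple.sort f₁).injective)
          intro i j hij
          simpa [Equiv.permCongr_apply, f₁] using this hij
        · have := (Tuple.monotone_sort f₂).strictMono_of_injective
            (i₂.comp (Tuple.sort f₂).injective)
          intro i j hij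
          simpa [Equiv.permCongr_apply, f₂] using this hij
      · refine Quotient.eq''.mpr (QuotientGroup.leftRel_apply.mpr ?_)
        refine ⟨((Tuple.sort f₁)⁻¹, (Tuple.sort f₂)⁻¹), ?_⟩
        have : finSumFinEquiv.symm.permCongr (finSumFinEquiv.permCongr
            (c * Equiv.Perm.sumCongr (Tuple.sort f₁) (Tuple.sort f₂))) =
            c * Equiv.Perm.sumCongr (Tuple.sort f₁) (Tuple.sort f₂) := by
          ext s
          simp [Equiv.permCongr_apply]
        rw [this, mul_inv_rev, mul_assoc, inv_mul_cancel, mul_one]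
        rfl
  · intro σ _
    rw [key]
    simp [Equiv.permCongr_apply]

theorem exists_altOf_differential [CharZero K] (b : M →ₗ[K] M →ₗ[K] M)
    (hb : ∀ x y, b x y = -b y x) (α β : M →ₗ[K] M) {n : ℕ} (f : M [⋀^Fin (n + 1)]→ₗ[K] M) :
    ∃ A : M [⋀^Fin (n + 2)]→ₗ[K] M, ∀ x : Fin (n + 2) → M,
      ∑ i : Fin (n + 2), (-1 : ℤ) ^ (i : ℕ) • b (β (x i)) (f (i.removeNth x)) +
      ∑ i : Fin (n + 1), ∑ j ∈ Finset.Ici i, (-1 : ℤ) ^ ((i : ℕ) + (j : ℕ) + 1) •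
        f (Matrix.vecCons (b (x i.castSucc) (x j.succ))
          (fun k => α (j.removeNth (i.castSucc.removeNth x) k))) = A x := by
  let S : M →ₗ[K] M [⋀^Fin (n + 1)]→ₗ[K] M :=
    { toFun := fun v => (b (β v)).compAlternatingMap f
      map_add' := fun v w => by
        ext
        simp
      map_smul' := fun c v => by
        ext
        simp }
  let T : M →ₗ[K] M →ₗ[K] M [⋀^Fin n]→ₗ[K] M :=
    LinearMap.mk₂ K (fun u v => (f.curryLeft (b u v)).compLinearMap α)
      (fun _ _ _ => by
        ext
        simp)
      (fun _ _ _ => by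
        ext
        simp)
      (fun _ _ _ => by
        ext
        simp)
      (fun _ _ _ => by
        ext
        simp)
  refine ⟨AlternatingMap.alternatizeUncurryFin S - (2⁻¹ : K) •
    AlternatingMap.alternatizeUncurryFin (AlternatingMap.alternatizeUncurryFinLM ∘ₗ T),
    fun x => ?_⟩
  have h2 : ∀ (i j : Fin (n + 1)),
      T (x i.castSucc) (x j.succ) (j.removeNth (i.castSucc.removeNth x)) -
        T (x j.succ) (x i.castSucc) (j.removeNth (i.castSucc.removeNth x)) =
      (2 : K) • f (Matrix.vecCons (b (x i.castSucc) (x j.succ))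
          (fun k => α (j.removeNth (i.castSucc.removeNth x) k))) := by
    intro i j
    have : T (x j.succ) (x i.castSucc) = -T (x i.castSucc) (x j.succ) := by
      ext y
      simp [T, hb (x j.succ) (x i.castSucc)]
    rw [this, AlternatingMap.neg_apply, sub_neg_eq_add, two_smul]
    rfl
  rw [AlternatingMap.sub_apply, AlternatingMap.smul_apply,
    AlternatingMap.alternatizeUncurryFin_alternatizeUncurryFinLM_comp_apply,
    AlternatingMap.alternatizeUncurryFin_apply, sub_eq_add_neg]
  congr 1
  simp only [h2, Finset.smul_sum, ← Finset.sum_neg_distrib]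
  refine Finset.sum_congr rfl fun i _ => Finset.sum_congr rfl fun j _ => ?_
  rw [smul_comm (2⁻¹ : K), smul_smul (2⁻¹ : K), inv_mul_cancel₀ two_ne_zero, one_smul, pow_succ,
    mul_neg_one, neg_smul]

end Helpers

/-! ### Cochains and the operations on them -/

section Cochains

variable {K g : Type*} [Field K] [AddCommGroup g] [Module K g]

/-- `C^n_Hom(g, g)`, for `n ≥ 1`: the alternating `n`-linear maps `f` on `g` with
`α ∘ f = f ∘ α^{∧n}`. -/
def HomCochain (α : g →ₗ[K] g) (n : ℕ) : Submodule K (g [⋀^Fin n]→ₗ[K] g) where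
  carrier := {f | ∀ x : Fin n → g, α (f x) = f (fun i => α (x i))}
  add_mem' hf hf' x := by simp [hf x, hf' x]
  zero_mem' x := by simp
  smul_mem' c f hf x := by simp [hf x]

theorem HomCochain.comm {α : g →ₗ[K] g} {n : ℕ} (f : HomCochain α n) (x : Fin n → g) :
    α (f.1 x) = f.1 (fun i => α (x i)) := f.2 x

/-- The contraction `i_P Q` of cochains `P` of degree `m + 1` and `Q` of degree `n + 1`. -/
def contractionAlt (α : g →ₗ[K] g) {m n : ℕ} (P : g [⋀^Fin (m + 1)]→ₗ[K] g)
    (Q : g [⋀^Fin (n + 1)]→ₗ[K] g) : g [⋀^Fin (m + n + 1)]→ₗ[K] g :=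
  altOfEq
    (fun x => ∑ σ ∈ shuffles (m + 1) n, Equiv.Perm.sign σ •
      Q (Matrix.vecCons
        (P fun i => x (Fin.cast (Nat.add_right_comm m 1 n) (σ (Fin.castAdd n i))))
        (fun j => (α ^ m) (x (Fin.cast (Nat.add_right_comm m 1 n) (σ (Fin.natAdd (m + 1) j)))))))
    (by
      obtain ⟨A, hA⟩ := exists_shuffleSum (q := n) P
        { toFun := fun v => (Q.curryLeft v).compLinearMap (α ^ m)
          map_add' := fun v w => by
            ext
            simp
          map_smul' := fun c v => by
            ext
            simp }
      exact ⟨A.domDomCongr (finCongr (Nat.add_right_comm m 1 n)), fun x =>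
        hA (fun i => x (finCongr (Nat.add_right_comm m 1 n) i))⟩)

/-- The cup product bracket `[P, Q]_C` of cochains `P` of degree `m + 1` and `Q` of degree
`n + 1`. -/
def cupAlt (𝔤 : HomLieAlgebra K g) {m n : ℕ} (P : g [⋀^Fin (m + 1)]→ₗ[K] g)
    (Q : g [⋀^Fin (n + 1)]→ₗ[K] g) : g [⋀^Fin ((m + 1) + (n + 1))]→ₗ[K] g :=
  altOfEq
    (fun x => ∑ σ ∈ shuffles (m + 1) (n + 1), Equiv.Perm.sign σ •
      𝔤.bracket ((𝔤.twist ^ n) (P fun i => x (σ (Fin.castAdd (n + 1) i))))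
        ((𝔤.twist ^ m) (Q fun j => x (σ (Fin.natAdd (m + 1) j)))))
    (exists_shuffleSum (q := n + 1) P
      { toFun := fun v =>
          (𝔤.bracket ((𝔤.twist ^ n) v) ∘ₗ (𝔤.twist ^ m)).compAlternatingMap Q
        map_add' := fun v w => by
          ext
          simp
        map_smul' := fun c v => by
          ext
          simp })

/-- The differential of a cochain of degree `n + 1`. With indices in `Fin (n + 2)` counted from
`0`, the pairs of indices `a < b` are written as `a = i.castSucc`, `b = j.succ` with `i ≤ j` in
`Fin (n + 1)`; so the sign `(-1) ^ (i + j + 1)` is `(-1) ^ (a + b)`, and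
`j.removeNth (i.castSucc.removeNth x)` is `x` with the entries `a` and `b` omitted. -/
def differentialAlt [CharZero K] (𝔤 : HomLieAlgebra K g) {n : ℕ}
    (f : g [⋀^Fin (n + 1)]→ₗ[K] g) : g [⋀^Fin (n + 2)]→ₗ[K] g :=
  altOfEq
    (fun x =>
      ∑ i : Fin (n + 2), (-1 : ℤ) ^ (i : ℕ) •
        𝔤.bracket ((𝔤.twist ^ n) (x i)) (f (i.removeNth x)) +
      ∑ i : Fin (n + 1), ∑ j ∈ Finset.Ici i, (-1 : ℤ) ^ ((i : ℕ) + (j : ℕ) + 1) •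
        f (Matrix.vecCons (𝔤.bracket (x i.castSucc) (x j.succ))
          (fun k => 𝔤.twist (j.removeNth (i.castSucc.removeNth x) k))))
    (exists_altOf_differential 𝔤.bracket 𝔤.skew 𝔤.twist (𝔤.twist ^ n) f)

theorem apply_vecCons {g : Type*} {n : ℕ} (α : g → g) (v : g) (y : Fin n → g) :
    (fun i => α (Matrix.vecCons v y i)) = Matrix.vecCons (α v) (fun i => α (y i)) := by
  funext i
  refine Fin.cases ?_ (fun i => ?_) i <;> simp

theorem apply_pow_comm (α : g →ₗ[K] g) (m : ℕ) (v : g) : α ((α ^ m) v) = (α ^ m) (α v) :=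
  LinearMap.congr_fun ((Commute.refl α).pow_right m).eq v

/-- `i_P Q` as a bilinear map `C^{m+1} × C^{n+1} → C^{m+n+1}`. -/
def contraction (α : g →ₗ[K] g) (m n : ℕ) :
    HomCochain α (m + 1) →ₗ[K] HomCochain α (n + 1) →ₗ[K] HomCochain α (m + n + 1) :=
  LinearMap.mk₂ K
    (fun P Q => ⟨contractionAlt α P.1 Q.1, fun x => by
      simp only [contractionAlt, altOfEq_apply, map_sum, Units.smul_def, map_zsmul,
        HomCochain.comm, apply_vecCons, apply_pow_comm]⟩)
    (fun P P' Q => by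
      ext x
      simp [contractionAlt, ← AlternatingMap.curryLeft_apply_apply, Finset.sum_add_distrib])
    (fun c P Q => by
      ext x
      simp [contractionAlt, ← AlternatingMap.curryLeft_apply_apply, Finset.smul_sum,
        smul_comm c, Units.smul_def])
    (fun P Q Q' => by
      ext x
      simp [contractionAlt, Finset.sum_add_distrib])
    (fun c P Q => by
      ext x
      simp [contractionAlt, Finset.smul_sum, smul_comm c, Units.smul_def])

/-- `[P, Q]_C` as a bilinear map `C^{m+1} × C^{n+1} → C^{(m+1)+(n+1)}`. -/
def cup (𝔤 : MultHomLieAlgebra K g) (m n : ℕ) :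
    HomCochain 𝔤.twist (m + 1) →ₗ[K] HomCochain 𝔤.twist (n + 1) →ₗ[K]
      HomCochain 𝔤.twist ((m + 1) + (n + 1)) :=
  LinearMap.mk₂ K
    (fun P Q => ⟨cupAlt 𝔤.toHomLieAlgebra P.1 Q.1, fun x => by
      simp only [cupAlt, altOfEq_apply, map_sum, Units.smul_def, map_zsmul,
        HomCochain.comm, 𝔤.map_bracket, apply_pow_comm]⟩)
    (fun P P' Q => by
      ext x
      simp [cupAlt, Finset.sum_add_distrib]
      rfl)
    (fun c P Q => by
      ext x
      simp [cupAlt, Finset.smul_sum, smul_comm c, Units.smul_def])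
    (fun P Q Q' => by
      ext x
      simp [cupAlt, Finset.sum_add_distrib]
      rfl)
    (fun c P Q => by
      ext x
      simp [cupAlt, Finset.smul_sum, smul_comm c, Units.smul_def])

/-- The differential as a linear map `C^{n+1} → C^{n+2}`. -/
def differential [CharZero K] (𝔤 : MultHomLieAlgebra K g) (n : ℕ) :
    HomCochain 𝔤.twist (n + 1) →ₗ[K] HomCochain 𝔤.twist (n + 2) where
  toFun f := ⟨differentialAlt 𝔤.toHomLieAlgebra f.1, fun x => by
    simp only [differentialAlt, altOfEq_apply, map_add, map_sum, map_zsmul,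
      HomCochain.comm, 𝔤.map_bracket, apply_pow_comm, apply_vecCons]
    rfl⟩
  map_add' f f' := by
    ext x
    simp [differentialAlt, Finset.sum_add_distrib]
    abel
  map_smul' c f := by
    ext x
    simp [differentialAlt, Finset.smul_sum, smul_comm c]

/-- The graded space `C^•_Hom(g, g) = ⨁_{n ≥ 1} C^n_Hom(g, g)`; the summand with index `n : ℕ`
is `C^{n+1}_Hom(g, g)`. -/
abbrev Cochains (α : g →ₗ[K] g) : Type _ := ⨁ n : ℕ, HomCochain α (n + 1)

/-- An element of `C^{n+1}_Hom(g, g)` as an element of `C^•_Hom(g, g)`. -/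
abbrev Cochains.of (α : g →ₗ[K] g) (n : ℕ) : HomCochain α (n + 1) →ₗ[K] Cochains α :=
  DirectSum.lof K ℕ (fun n => HomCochain α (n + 1)) n

/-- The grading of `C^{•+s}_Hom(g, g)`: its piece of degree `i` is `C^{i+s}_Hom(g, g)` (which is
zero if `i + s ≤ 0`). -/
def Cochains.grading (α : g →ₗ[K] g) (s : ℤ) (i : ℤ) : Submodule K (Cochains α) where
  carrier := {P | ∀ n : ℕ, (n : ℤ) + 1 ≠ i + s → P n = 0}
  add_mem' hP hQ n hn := by simp [hP n hn, hQ n hn]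
  zero_mem' n _ := by simp
  smul_mem' c P hP n hn := by rw [DirectSum.smul_apply, hP n hn, smul_zero]

/-- The bilinear extension to `C^•_Hom(g, g)` of bilinear maps given on homogeneous cochains. -/
def Cochains.bilinear (α : g →ₗ[K] g)
    (B : ∀ m n : ℕ, HomCochain α (m + 1) →ₗ[K] HomCochain α (n + 1) →ₗ[K] Cochains α) :
    Cochains α →ₗ[K] Cochains α →ₗ[K] Cochains α :=
  DirectSum.toModule K ℕ _ fun m =>
    (DirectSum.toModule K ℕ _ fun n => (B m n).flip).flip

/-- The Nijenhuis-Richardson bracket: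
`[P, Q]_NR = i_P Q - (-1)^{mn} i_Q P` for `P` in `C^{m+1}` and `Q` in `C^{n+1}`. -/
def nrBracket (α : g →ₗ[K] g) : Cochains α →ₗ[K] Cochains α →ₗ[K] Cochains α :=
  Cochains.bilinear α fun m n => LinearMap.mk₂ K
    (fun P Q => Cochains.of α (m + n) (contraction α m n P Q) -
      (-1 : ℤ) ^ (m * n) • Cochains.of α (n + m) (contraction α n m Q P))
    (fun P P' Q => by simp only [map_add, LinearMap.add_apply, smul_add]; abel)
    (fun c P Q => by simp only [map_smul, LinearMap.smul_apply, smul_sub, smul_comm c])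
    (fun P Q Q' => by simp only [map_add, LinearMap.add_apply, smul_add]; abel)
    (fun c P Q => by simp only [map_smul, LinearMap.smul_apply, smul_sub, smul_comm c])

/-- The Frölicher-Nijenhuis bracket:
`[P, Q]_FN = [P, Q]_C + (-1)^m i_{δP} Q - (-1)^{(m+1)n} i_{δQ} P` for `P` in `C^m` and `Q` in
`C^n`, written below with `m + 1` and `n + 1` in place of `m` and `n`. -/
def fnBracket [CharZero K] (𝔤 : MultHomLieAlgebra K g) :
    Cochains 𝔤.twist →ₗ[K] Cochains 𝔤.twist →ₗ[K] Cochains 𝔤.twist :=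
  Cochains.bilinear 𝔤.twist fun m n => LinearMap.mk₂ K
    (fun P Q => Cochains.of 𝔤.twist (m + 1 + n) (cup 𝔤 m n P Q) +
      (-1 : ℤ) ^ (m + 1) •
        Cochains.of 𝔤.twist (m + 1 + n) (contraction 𝔤.twist (m + 1) n (differential 𝔤 m P) Q) -
      (-1 : ℤ) ^ (((m + 1) + 1) * (n + 1)) •
        Cochains.of 𝔤.twist (n + 1 + m) (contraction 𝔤.twist (n + 1) m (differential 𝔤 n Q) P))
    (fun P P' Q => by simp only [map_add, LinearMap.add_apply, smul_add]; abel)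
    (fun c P Q => by
      simp only [map_smul, LinearMap.smul_apply, smul_sub, smul_add, smul_comm c])
    (fun P Q Q' => by simp only [map_add, LinearMap.add_apply, smul_add]; abel)
    (fun c P Q => by
      simp only [map_smul, LinearMap.smul_apply, smul_sub, smul_add, smul_comm c])

/-- The differential `δ_Hom` on `C^•_Hom(g, g)`. -/
def deltaHom [CharZero K] (𝔤 : MultHomLieAlgebra K g) :
    Cochains 𝔤.twist →ₗ[K] Cochains 𝔤.twist :=
  DirectSum.toModule K ℕ _ fun n => Cochains.of 𝔤.twist (n + 1) ∘ₗ differential 𝔤 n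

end Cochains

end

/-!
Everything takes place in the graded space of cochains with `C^{n+1}_Hom(g, g)` in degree `n` and
with the product `P · Q = i_P Q`. This is a left graded pre-Lie product: `P · (Q · R) - (P · Q) · R`
is, up to sign, the simultaneous insertion of `P` and `Q` into two slots of `R`, and this is graded
symmetric in `P` and `Q`. So its graded commutator, the Nijenhuis-Richardson bracket, satisfies
the graded Jacobi identity.

Let `μ` be the bracket of `g`, a cochain of degree `1`. The Hom-Jacobi identity says `μ · μ = 0`,
the differential is `δ = -[μ, -]_NR`, hence a derivation of square zero, and as `μ` has only two
slots, the insertion of `P` and `Q` into `μ` is the cup bracket: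
`P · (Q · μ) - (P · Q) · μ = (-1)^n [P, Q]_C` for `Q` of degree `n`. It follows that
`[P, Q]_FN = [P, δ Q]_NR - (-1)^m δ (P · Q)` for `P` of degree `m` (`IsPreLieCup.fn_eq_delta`), and
applying `δ` gives `δ [P, Q]_FN = [δ P, δ Q]_NR` (`IsPreLieCup.delta_fn`).

The cup bracket is a graded Lie bracket on which the Nijenhuis-Richardson algebra acts by the
derivations `P · -`. By the identity for `δ`, the map `P ↦ (P, ± δ P)` carries the
Frölicher-Nijenhuis bracket to the bracket of the semidirect product of these two Lie algebras,
whence its Jacobi identity (`IsPreLieCup.fn_jacobi`).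

The identities between cochains (associator, derivation property, Jacobi identity of the cup
bracket) are proved on lists of vectors. A sum over shuffles is the signed sum `unshuffleSum` over
all ways to distribute a list over two sublists (`sum_shuffles_eq_unshuffleSum`), and this
sum, defined by recursion on the list, is coassociative and graded cocommutative
(`unshuffleSum_assoc`, `unshuffleSum_comm`). On lists, cochains whose degrees
are equal but not definitionally so can be compared without casts.
-/

noncomputable section

/-! ### Values of alternating maps on lists -/

section ListEvaluation

variable {R M N : Type*} [CommRing R] [AddCommGroup M] [Module R M] [AddCommGroup N]
  [Module R N]

/-- The value of an alternating map of `n` arguments on a list: the value on the entries of the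
list if its length is `n`, and `0` otherwise. -/
def AlternatingMap.evalList : {n : ℕ} → (M [⋀^Fin n]→ₗ[R] N) → List M → N
  | 0, f, [] => f ![]
  | 0, _, _ :: _ => 0
  | _ + 1, _, [] => 0
  | _ + 1, f, x :: l => (f.curryLeft x).evalList l

namespace AlternatingMap

theorem evalList_cons {n : ℕ} (f : M [⋀^Fin (n + 1)]→ₗ[R] N) (x : M) (l : List M) :
    f.evalList (x :: l) = (f.curryLeft x).evalList l := rfl

theorem evalList_ofFn {n : ℕ} (f : M [⋀^Fin n]→ₗ[R] N) (x : Fin n → M) :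
    f.evalList (List.ofFn x) = f x := by
  induction n with
  | zero =>
    rw [List.ofFn_zero]
    exact congrArg f (Subsingleton.elim _ _)
  | succ n ih =>
    rw [List.ofFn_succ, evalList_cons, ih, curryLeft_apply_apply]
    congr 1
    exact Matrix.cons_head_tail x

theorem evalList_eq_zero {n : ℕ} (f : M [⋀^Fin n]→ₗ[R] N) {l : List M} (h : l.length ≠ n) :
    f.evalList l = 0 := by
  induction n generalizing l with
  | zero => cases l with
    | nil => simp at h
    | cons x l => rfl
  | succ n ih => cases l with
    | nil => rfl
    | cons x l => exact ih _ (by simpa using h)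

theorem evalList_add {n : ℕ} (f f' : M [⋀^Fin n]→ₗ[R] N) (l : List M) :
    (f + f').evalList l = f.evalList l + f'.evalList l := by
  induction n generalizing l with
  | zero => cases l <;> simp [evalList]
  | succ n ih => cases l with
    | nil => simp [evalList]
    | cons x l => simp only [evalList_cons, curryLeft_add, LinearMap.add_apply, ih]

theorem evalList_smul {n : ℕ} (c : R) (f : M [⋀^Fin n]→ₗ[R] N) (l : List M) :
    (c • f).evalList l = c • f.evalList l := by
  induction n generalizing l with
  | zero => cases l <;> simp [evalList]
  | succ n ih => cases l with
    | nil => simp [evalList]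
    | cons x l => simp only [evalList_cons, curryLeft_smul, LinearMap.smul_apply, ih]

/-- The value on `x :: l`, as a linear map in `x`. -/
def evalListHead {n : ℕ} (f : M [⋀^Fin (n + 1)]→ₗ[R] N) (l : List M) : M →ₗ[R] N where
  toFun x := f.evalList (x :: l)
  map_add' x y := by simp only [evalList_cons, map_add, evalList_add]
  map_smul' c x := by simp only [evalList_cons, map_smul, evalList_smul, RingHom.id_apply]

theorem evalList_swap {n : ℕ} (f : M [⋀^Fin n]→ₗ[R] N) (k : List M) (x y : M) (l : List M) :
    f.evalList (k ++ x :: y :: l) = -f.evalList (k ++ y :: x :: l) := by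
  induction k generalizing n with
  | nil =>
    match n with
    | 0 => simp [evalList]
    | 1 => simp [evalList]
    | n + 2 =>
      have h : (f.curryLeft x).curryLeft y = -(f.curryLeft y).curryLeft x := by
        ext v
        simp only [neg_apply, curryLeft_apply_apply]
        rw [← f.map_swap _ (i := 0) (j := 1) (by simp)]
        congr 1
        funext i
        refine Fin.cases (by simp) (fun i => ?_) i
        refine Fin.cases (by simp) (fun i => ?_) i
        rw [Function.comp_apply, Equiv.swap_apply_of_ne_of_ne (Fin.succ_ne_zero _)
          (by simp [Fin.ext_iff])]
        simp
      have hneg : -((f.curryLeft y).curryLeft x) = (-1 : R) • (f.curryLeft y).curryLeft x := by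
        simp
      simp only [List.nil_append, evalList_cons, h]
      rw [hneg, evalList_smul, neg_one_smul]
  | cons z k ih => cases n with
    | zero => simp [evalList]
    | succ n => simp only [List.cons_append, evalList_cons, ih]

/-- Moving the entry `x` past the entries `a` costs the sign of `unshuffleSum`. -/
theorem evalList_move {n : ℕ} (f : M [⋀^Fin n]→ₗ[R] N) (k a : List M) (x : M) (b : List M) :
    f.evalList (k ++ (a ++ x :: b)) = (-1 : ℤ) ^ a.length • f.evalList (k ++ x :: (a ++ b)) := by
  induction a generalizing k with
  | nil => simp
  | cons y a ih =>
    have := ih (k ++ [y])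
    simp only [List.append_assoc, List.cons_append, List.nil_append] at this
    rw [List.cons_append, this, evalList_swap, List.length_cons, pow_succ, smul_neg]
    simp

end AlternatingMap

end ListEvaluation

/-! ### The unshuffle coproduct -/

section Unshuffle

variable {M M' N N' : Type*} [AddCommGroup N] [AddCommGroup N']

/-- The signed sum of `F a b` over all ways to distribute the entries of a list over two
sublists `a` and `b`; the sign is that of the permutation that takes the list to `a ++ b`. -/
def unshuffleSum : List M → (List M → List M → N) → N
  | [], F => F [] []
  | x :: l, F => unshuffleSum l (fun a b => F (x :: a) b) +
      unshuffleSum l (fun a b => (-1 : ℤ) ^ a.length • F a (x :: b))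

theorem unshuffleSum_cons (x : M) (l : List M) (F : List M → List M → N) :
    unshuffleSum (x :: l) F = unshuffleSum l (fun a b => F (x :: a) b) +
      unshuffleSum l (fun a b => (-1 : ℤ) ^ a.length • F a (x :: b)) := rfl

theorem unshuffleSum_congr {l : List M} {F G : List M → List M → N}
    (h : ∀ a b, a.length + b.length = l.length → F a b = G a b) :
    unshuffleSum l F = unshuffleSum l G := by
  induction l generalizing F G with
  | nil => exact h [] [] rfl
  | cons x l ih =>
    rw [unshuffleSum_cons, unshuffleSum_cons]
    congr 1
    · exact ih fun a b hab => h (x :: a) b (by simp only [List.length_cons]; omega)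
    · refine ih fun a b hab => ?_
      rw [h a (x :: b) (by simp only [List.length_cons]; omega)]

theorem map_unshuffleSum {Φ : Type*} [FunLike Φ N N'] [AddMonoidHomClass Φ N N'] (φ : Φ)
    (l : List M) (F : List M → List M → N) :
    φ (unshuffleSum l F) = unshuffleSum l fun a b => φ (F a b) := by
  induction l generalizing F with
  | nil => rfl
  | cons x l ih => simp only [unshuffleSum_cons, map_add, ih, map_zsmul]

theorem unshuffleSum_zero (l : List M) : unshuffleSum l (fun _ _ => (0 : N)) = 0 := by
  induction l with
  | nil => rfl
  | cons x l ih => simp [unshuffleSum_cons, ih]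

theorem unshuffleSum_add (l : List M) (F G : List M → List M → N) :
    unshuffleSum l (fun a b => F a b + G a b) = unshuffleSum l F + unshuffleSum l G := by
  induction l generalizing F G with
  | nil => rfl
  | cons x l ih =>
    simp only [unshuffleSum_cons, smul_add, ih]
    abel

theorem unshuffleSum_zsmul (l : List M) (c : ℤ) (F : List M → List M → N) :
    unshuffleSum l (fun a b => c • F a b) = c • unshuffleSum l F :=
  (map_unshuffleSum (zsmulAddGroupHom c : N →+ N) l F).symm

theorem unshuffleSum_neg (l : List M) (F : List M → List M → N) :
    unshuffleSum l (fun a b => -F a b) = -unshuffleSum l F :=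
  (map_unshuffleSum (negAddMonoidHom : N →+ N) l F).symm

theorem unshuffleSum_map (f : M → M') (l : List M) (F : List M' → List M' → N) :
    unshuffleSum (l.map f) F = unshuffleSum l fun a b => F (a.map f) (b.map f) := by
  induction l generalizing F with
  | nil => rfl
  | cons x l ih => simp only [List.map_cons, unshuffleSum_cons, ih, List.length_map]

/-- Coassociativity of the unshuffle coproduct. -/
theorem unshuffleSum_assoc (l : List M) (F : List M → List M → List M → N) :
    unshuffleSum l (fun e d => unshuffleSum e fun a c => F a c d) =
      unshuffleSum l (fun a e => unshuffleSum e fun c d => F a c d) := by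
  induction l generalizing F with
  | nil => rfl
  | cons x l ih =>
    simp only [unshuffleSum_cons, unshuffleSum_add, ← unshuffleSum_zsmul, smul_add]
    rw [ih, ih (fun a c d => (-1 : ℤ) ^ a.length • F a (x :: c) d), add_assoc]
    congr 2
    rw [← ih]
    refine unshuffleSum_congr fun a b _ => unshuffleSum_congr fun c d h => ?_
    rw [smul_smul, ← pow_add, h]

/-- Graded cocommutativity of the unshuffle coproduct. -/
theorem unshuffleSum_comm (l : List M) (F : List M → List M → N) :
    unshuffleSum l F =
      unshuffleSum l fun a b => (-1 : ℤ) ^ (a.length * b.length) • F b a := by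
  induction l generalizing F with
  | nil => simp [unshuffleSum]
  | cons x l ih =>
    rw [unshuffleSum_cons, unshuffleSum_cons, add_comm, ih, ih (fun a b => F (x :: a) b)]
    congr 1
    · refine unshuffleSum_congr fun a b _ => ?_
      rw [smul_smul, List.length_cons, ← pow_add, add_mul, one_mul]
    · refine unshuffleSum_congr fun a b _ => ?_
      rw [smul_smul, List.length_cons, ← pow_add, mul_add, mul_one, add_comm a.length, add_assoc,
        pow_add, Even.neg_one_pow (Even.add_self a.length), mul_one]

end Unshuffle

/-! ### Shuffles and distributions of lists -/

section Splits

variable {M : Type*}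

/-- The ways to distribute the entries of a list over two sublists. -/
def List.splits : List M → List (List M × List M)
  | [] => [([], [])]
  | x :: l => l.splits.map (fun s => (x :: s.1, s.2)) ++ l.splits.map (fun s => (s.1, x :: s.2))

theorem List.perm_of_mem_splits {l : List M} {s : List M × List M} (h : s ∈ l.splits) :
    (s.1 ++ s.2).Perm l := by
  induction l generalizing s with
  | nil =>
    simp only [List.splits, List.mem_singleton] at h
    subst h
    exact List.Perm.refl _
  | cons x l ih =>
    simp only [List.splits, List.mem_append, List.mem_map] at h
    obtain ⟨t, ht, rfl⟩ | ⟨t, ht, rfl⟩ := h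
    · exact (ih ht).cons x
    · exact List.perm_middle.trans ((ih ht).cons x)

theorem List.sublist_of_mem_splits {l : List M} {s : List M × List M} (h : s ∈ l.splits) :
    s.1.Sublist l ∧ s.2.Sublist l := by
  induction l generalizing s with
  | nil =>
    simp only [List.splits, List.mem_singleton] at h
    subst h
    exact ⟨List.Sublist.refl _, List.Sublist.refl _⟩
  | cons x l ih =>
    simp only [List.splits, List.mem_append, List.mem_map] at h
    obtain ⟨t, ht, rfl⟩ | ⟨t, ht, rfl⟩ := h
    · exact ⟨(ih ht).1.cons_cons x, (ih ht).2.cons x⟩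
    · exact ⟨(ih ht).1.cons x, (ih ht).2.cons_cons x⟩

theorem List.nodup_splits {l : List M} (h : l.Nodup) : l.splits.Nodup := by
  induction l with
  | nil => simp [List.splits]
  | cons x l ih =>
    rw [List.nodup_cons] at h
    refine List.Nodup.append ((ih h.2).map ?_) ((ih h.2).map ?_) ?_
    · rintro ⟨a, b⟩ ⟨c, d⟩ hs
      simpa using hs
    · rintro ⟨a, b⟩ ⟨c, d⟩ hs
      simpa using hs
    · intro s hs ht
      obtain ⟨u, hu, rfl⟩ := List.mem_map.mp hs
      obtain ⟨v, hv, hvu⟩ := List.mem_map.mp ht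
      have : v.1 = x :: u.1 := congrArg Prod.fst hvu
      exact h.1 ((List.sublist_of_mem_splits hv).1.subset (by simp [this]))

/-- The distributions of a strictly increasing list are the pairs of strictly increasing lists that
together contain its entries. -/
theorem List.mem_splits_of_perm [LinearOrder M] {l a b : List M} (hl : l.Pairwise (· < ·))
    (ha : a.Pairwise (· < ·)) (hb : b.Pairwise (· < ·)) (h : (a ++ b).Perm l) :
    (a, b) ∈ l.splits := by
  -- An increasing list with entries in `x :: l` that contains `x` starts with `x`.
  have head : ∀ {x : M} {l c : List M}, (x :: l).Pairwise (· < ·) → c.Pairwise (· < ·) →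
      c ⊆ x :: l → x ∈ c → ∃ c', c = x :: c' := by
    intro x l c hl hc hcl hx
    cases c with
    | nil => simp at hx
    | cons y c =>
      refine ⟨c, ?_⟩
      rcases List.mem_cons.mp hx with rfl | hx
      · rfl
      · rcases List.mem_cons.mp (hcl List.mem_cons_self) with rfl | hy
        · rfl
        · exact absurd ((List.pairwise_cons.mp hl).1 y hy)
            (not_lt_of_gt ((List.pairwise_cons.mp hc).1 x hx))
  induction l generalizing a b with
  | nil =>
    have := h.eq_nil
    simp only [List.append_eq_nil_iff] at this
    simp [List.splits, this]
  | cons x l ih =>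
    have hl' := (List.pairwise_cons.mp hl).2
    simp only [List.splits, List.mem_append, List.mem_map]
    rcases List.mem_append.mp (h.symm.subset List.mem_cons_self) with hx | hx
    · obtain ⟨a, rfl⟩ := head hl ha (fun y hy => h.subset (List.mem_append_left _ hy)) hx
      exact Or.inl ⟨(a, b), ih hl' (List.pairwise_cons.mp ha).2 hb h.cons_inv, rfl⟩
    · obtain ⟨b, rfl⟩ := head hl hb (fun y hy => h.subset (List.mem_append_right _ hy)) hx
      exact Or.inr ⟨(a, b), ih hl' ha (List.pairwise_cons.mp hb).2
        (List.perm_middle.symm.trans h).cons_inv, rfl⟩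

theorem unshuffleSum_eq_of_right_nil {N : Type*} [AddCommGroup N] (l : List M)
    (F : List M → List M → N) (hF : ∀ a b, b ≠ [] → F a b = 0) :
    unshuffleSum l F = F l [] := by
  induction l generalizing F with
  | nil => rfl
  | cons x l ih =>
    rw [unshuffleSum_cons, ih _ fun a b hb => hF _ b hb]
    simp [hF _ (x :: _) (List.cons_ne_nil _ _), unshuffleSum_zero]

theorem unshuffleSum_eq_of_left_nil {N : Type*} [AddCommGroup N] (l : List M)
    (F : List M → List M → N) (hF : ∀ a b, a ≠ [] → F a b = 0) :
    unshuffleSum l F = F [] l := by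
  rw [unshuffleSum_comm, unshuffleSum_eq_of_right_nil]
  · simp
  · intro a b hb
    rw [hF b a hb, smul_zero]

theorem List.ofFn_removeNth_succ {n : ℕ} (x : Fin (n + 2) → M) (i : Fin (n + 1)) :
    List.ofFn (i.succ.removeNth x) = x 0 :: List.ofFn (i.removeNth (Fin.tail x)) := by
  rw [List.ofFn_succ]
  simp only [Fin.removeNth, Fin.succ_succAbove_zero, Fin.succ_succAbove_succ]
  rfl

/-- The sum over the distributions of `x` with one entry on the left is the alternating sum over
the omitted entry. -/
theorem sum_removeNth_eq_unshuffleSum {N : Type*} [AddCommGroup N] {n : ℕ}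
    (F : List M → List M → N) (hF : ∀ a b, a.length ≠ 1 → F a b = 0) (x : Fin (n + 1) → M) :
    ∑ i : Fin (n + 1), (-1 : ℤ) ^ (i : ℕ) • F [x i] (List.ofFn (i.removeNth x)) =
      unshuffleSum (List.ofFn x) F := by
  induction n generalizing F with
  | zero =>
    simp [unshuffleSum, hF []]
  | succ n ih =>
    have h := ih (fun a b => F a (x 0 :: b)) (fun a b h => hF _ _ h) (Fin.tail x)
    rw [Fin.sum_univ_succ, List.ofFn_succ (f := x), unshuffleSum_cons,
      unshuffleSum_eq_of_left_nil]
    · congr 1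
      · simp [Fin.tail]
      · simp only [List.ofFn_removeNth_succ, Fin.val_succ, pow_succ, mul_neg_one, neg_smul]
        rw [Finset.sum_neg_distrib]
        refine (congrArg Neg.neg h).trans ?_
        rw [← unshuffleSum_neg]
        refine unshuffleSum_congr fun a b _ => ?_
        by_cases ha : a.length = 1
        · simp [ha]
        · simp [hF _ _ ha]
    · intro a b ha
      exact hF _ _ (by simpa using ha)

/-- The sum over the distributions of `x` with two entries on the left is the sum over the pairs
of omitted entries. -/
theorem sum_removeNth_removeNth_eq_unshuffleSum {N : Type*} [AddCommGroup N] {n : ℕ}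
    (F : List M → List M → N) (hF : ∀ a b, a.length ≠ 2 → F a b = 0) (x : Fin (n + 2) → M) :
    ∑ i : Fin (n + 1), ∑ j ∈ Finset.Ici i, (-1 : ℤ) ^ ((i : ℕ) + (j : ℕ)) •
      F [x i.castSucc, x j.succ] (List.ofFn (j.removeNth (i.castSucc.removeNth x))) =
      unshuffleSum (List.ofFn x) F := by
  have hIci : ∀ {n : ℕ} (i : Fin n) (f : Fin n → N),
      ∑ j ∈ Finset.Ici i, f j = ∑ j, if i ≤ j then f j else 0 := by
    intro n i f
    rw [← Finset.sum_filter]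
    congr 1
    ext j
    simp
  induction n generalizing F with
  | zero =>
    simp [hIci, unshuffleSum, hF [], hF [_]]
  | succ n ih =>
    have h0 := sum_removeNth_eq_unshuffleSum (fun a b => F (x 0 :: a) b)
      (fun a b h => hF _ _ (by simpa using h)) (Fin.tail x)
    have h1 := ih (fun a b => F a (x 0 :: b)) (fun a b h => hF _ _ h) (Fin.tail x)
    have htail : ∀ i : Fin (n + 1), Fin.tail (i.succ.castSucc.removeNth x) =
        i.castSucc.removeNth (Fin.tail x) := by
      intro i
      funext k
      simp [Fin.removeNth, Fin.tail]
    simp only [hIci] at h1 ⊢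
    rw [List.ofFn_succ, unshuffleSum_cons, Fin.sum_univ_succ]
    congr 1
    · simp only [Fin.zero_le, if_true, Fin.val_zero, zero_add, Fin.castSucc_zero]
      exact h0
    -- Only distributions with two entries on the left contribute, so the sign is `1`.
    · have h2 : unshuffleSum (List.ofFn fun i : Fin (n + 2) => x i.succ)
          (fun a b => (-1 : ℤ) ^ a.length • F a (x 0 :: b)) =
          unshuffleSum (List.ofFn (Fin.tail x)) (fun a b => F a (x 0 :: b)) := by
        refine unshuffleSum_congr fun a b _ => ?_
        by_cases ha : a.length = 2
        · simp [ha]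
        · simp [hF _ _ ha]
      rw [h2, ← h1]
      refine Finset.sum_congr rfl fun i _ => ?_
      rw [Fin.sum_univ_succ, if_neg (by simp), zero_add]
      refine Finset.sum_congr rfl fun j _ => ?_
      rw [List.ofFn_removeNth_succ, htail]
      have hs : (-1 : ℤ) ^ ((i.succ : ℕ) + (j.succ : ℕ)) = (-1) ^ ((i : ℕ) + (j : ℕ)) := by
        rw [Fin.val_succ, Fin.val_succ, add_add_add_comm, pow_add _ _ (1 + 1)]
        simp
      simp only [hs, Fin.succ_le_succ_iff]
      rfl

/-- The signs in `unshuffleSum` can be read off from any alternating map `D`: multiplied by the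
value of `D` on the list, the sign of a distribution `(a, b)` is the value of `D` on `a ++ b`. The
prefix `k` is there for the induction. -/
theorem evalList_smul_unshuffleSum {V N : Type*} [AddCommGroup V] [AddCommGroup N] {n : ℕ}
    (D : V [⋀^Fin n]→ₗ[ℤ] ℤ) (v : M → V) (k l : List M) (F : List M → List M → N) :
    D.evalList ((k ++ l).map v) • unshuffleSum l F =
      (l.splits.map fun s => D.evalList ((k ++ (s.1 ++ s.2)).map v) • F s.1 s.2).sum := by
  induction l generalizing k F with
  | nil => simp [List.splits, unshuffleSum]
  | cons x l ih =>
    have h := ih (k ++ [x])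
    simp only [List.append_assoc, List.cons_append, List.nil_append] at h
    rw [unshuffleSum_cons, smul_add, h, h, List.splits, List.map_append, List.sum_append,
      List.map_map, List.map_map]
    congr 2
    refine List.map_congr_left fun s _ => ?_
    have hs : D.evalList ((k ++ (s.1 ++ x :: s.2)).map v) =
        (-1 : ℤ) ^ s.1.length • D.evalList ((k ++ x :: (s.1 ++ s.2)).map v) := by
      simpa using D.evalList_move (k.map v) (s.1.map v) (v x) (s.2.map v)
    rw [Function.comp_apply, hs, smul_eq_mul, mul_comm, mul_smul]

/-- The sum over shuffles is the sum over the distributions of a list over two sublists: a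
shuffle `σ` corresponds to the pair of its lists of values on the first `p` and on the last `q`
indices, and both signs are the determinant of the permuted standard basis. -/
theorem sum_shuffles_eq_unshuffleSum {N : Type*} [AddCommGroup N] {p q : ℕ}
    (F : List M → List M → N) (hF : ∀ a b, a.length ≠ p → F a b = 0) (x : Fin (p + q) → M) :
    ∑ σ ∈ shuffles p q, Equiv.Perm.sign σ •
      F (List.ofFn fun i => x (σ (Fin.castAdd q i))) (List.ofFn fun j => x (σ (Fin.natAdd p j))) =
      unshuffleSum (List.ofFn x) F := by
  classical
  let D := (Pi.basisFun ℤ (Fin (p + q))).det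
  let v : Fin (p + q) → Fin (p + q) → ℤ := Pi.basisFun ℤ (Fin (p + q))
  have hD : ∀ σ : Equiv.Perm (Fin (p + q)),
      D.evalList ((List.ofFn σ).map v) = Equiv.Perm.sign σ := by
    intro σ
    rw [List.map_ofFn, AlternatingMap.evalList_ofFn]
    have hv : D v = 1 := Module.Basis.det_self _
    refine (D.map_perm v σ).trans ?_
    rw [hv, Units.smul_def, smul_eq_mul, mul_one]
  have hD1 : D.evalList ((List.finRange (p + q)).map v) = 1 := by
    have := hD 1
    rwa [Equiv.Perm.sign_one, Units.val_one, Equiv.Perm.coe_one, List.ofFn_id] at this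
  have hcat : ∀ σ : Equiv.Perm (Fin (p + q)), (List.ofFn fun i => σ (Fin.castAdd q i)) ++
      (List.ofFn fun j => σ (Fin.natAdd p j)) = List.ofFn σ := by
    intro σ
    rw [← List.ofFn_fin_append]
    congr 1
    funext i
    refine Fin.addCases (fun i => ?_) (fun j => ?_) i <;> simp
  have hx : List.ofFn x = (List.finRange (p + q)).map x := List.ofFn_eq_map
  have h := evalList_smul_unshuffleSum D v [] (List.finRange (p + q))
    (fun a b => F (a.map x) (b.map x))
  rw [List.nil_append, hD1, one_smul] at h
  rw [hx, unshuffleSum_map, h,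
    ← List.sum_toFinset _ (List.nodup_splits (List.nodup_finRange (p + q)))]
  refine Finset.sum_of_injOn
    (fun σ => (List.ofFn fun i => σ (Fin.castAdd q i), List.ofFn fun j => σ (Fin.natAdd p j)))
    ?_ ?_ ?_ ?_
  · intro σ _ τ _ hστ
    have := (hcat σ).symm.trans
      ((congrArg₂ (· ++ ·) (congrArg Prod.fst hστ) (congrArg Prod.snd hστ)).trans (hcat τ))
    exact Equiv.coe_fn_injective (List.ofFn_injective this)
  · intro σ hσ
    have hσ := mem_shuffles.mp hσ
    rw [Finset.mem_coe, List.mem_toFinset]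
    refine List.mem_splits_of_perm (List.pairwise_lt_finRange _)
      (List.pairwise_ofFn.mpr fun i j hij => hσ.1 hij)
      (List.pairwise_ofFn.mpr fun i j hij => hσ.2 hij) ?_
    rw [hcat]
    refine (List.perm_ext_iff_of_nodup (List.nodup_ofFn.mpr σ.injective)
      (List.nodup_finRange _)).mpr fun i => ?_
    simpa [List.mem_ofFn] using σ.surjective i
  · rintro ⟨a, b⟩ hs hns
    rw [List.mem_toFinset] at hs
    by_cases hap : a.length = p
    · exfalso
      refine hns ?_
      have hperm := List.perm_of_mem_splits hs
      have hsub := List.sublist_of_mem_splits hs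
      have hbq : b.length = q := by
        have := hperm.length_eq
        simp only [List.length_append, List.length_finRange] at this
        omega
      obtain ⟨f, rfl⟩ : ∃ f : Fin p → Fin (p + q), a = List.ofFn f := by
        clear hns hD hD1 hcat hx h hs hF hperm hsub
        generalize p + q = n at *
        subst hap
        exact ⟨a.get, (List.ofFn_get a).symm⟩
      obtain ⟨f', rfl⟩ : ∃ f : Fin q → Fin (p + q), b = List.ofFn f := by
        clear hns hD hD1 hcat hx h hs hF hperm hsub
        generalize p + q = n at *
        subst hbq
        exact ⟨b.get, (List.ofFn_get b).symm⟩
      have hinj : Function.Injective (Fin.append f f') := by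
        rw [← List.nodup_ofFn, List.ofFn_fin_append]
        exact hperm.symm.nodup (List.nodup_finRange _)
      refine ⟨Equiv.ofBijective _ (Finite.injective_iff_bijective.mp hinj), ?_, ?_⟩
      · rw [Finset.mem_coe, mem_shuffles]
        constructor
        · intro i j hij
          have := List.pairwise_ofFn.mp ((List.pairwise_lt_finRange _).sublist hsub.1) hij
          simpa using this
        · intro i j hij
          have := List.pairwise_ofFn.mp ((List.pairwise_lt_finRange _).sublist hsub.2) hij
          simpa using this
      · simp
    · simp only
      rw [hF _ _ (by simpa using hap), smul_zero]
  · intro σ _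
    simp only [List.nil_append, hcat, hD, Units.smul_def]
    rw [List.map_ofFn, List.map_ofFn]
    rfl

end Splits

/-! ### Contraction, cup bracket and differential on lists -/

section Evaluation

variable {K g : Type*} [Field K] [AddCommGroup g] [Module K g]

theorem AlternatingMap.evalList_cons_ofFn {n : ℕ} (f : g [⋀^Fin (n + 1)]→ₗ[K] g) (v : g)
    (x : Fin n → g) : f.evalList (v :: List.ofFn x) = f (Matrix.vecCons v x) := by
  rw [evalList_cons, evalList_ofFn, curryLeft_apply_apply]

theorem AlternatingMap.evalList_zero_cons {n : ℕ} (f : g [⋀^Fin n]→ₗ[K] g) (l : List g) :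
    f.evalList (0 :: l) = 0 := by
  cases n with
  | zero => rfl
  | succ n => exact _root_.map_zero (f.evalListHead l)

theorem AlternatingMap.evalList_cons_zero_cons {n : ℕ} (f : g [⋀^Fin n]→ₗ[K] g) (x : g)
    (l : List g) : f.evalList (x :: 0 :: l) = 0 := by
  cases n with
  | zero => rfl
  | succ n => exact (f.curryLeft x).evalList_zero_cons l

theorem AlternatingMap.evalList_cons_unshuffleSum {n : ℕ} (f : g [⋀^Fin (n + 1)]→ₗ[K] g)
    (l k : List g) (F : List g → List g → g) :
    f.evalList (unshuffleSum l F :: k) = unshuffleSum l fun a b => f.evalList (F a b :: k) :=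
  map_unshuffleSum (f.evalListHead k) l F

theorem AlternatingMap.evalList_swap_head {n : ℕ} (f : g [⋀^Fin n]→ₗ[K] g) (x y : g)
    (l : List g) : f.evalList (x :: y :: l) = -f.evalList (y :: x :: l) :=
  f.evalList_swap [] x y l

theorem List.exists_ofFn_eq {M : Type*} {l : List M} {n : ℕ} (h : l.length = n) :
    ∃ x : Fin n → M, l = List.ofFn x := by
  subst h
  exact ⟨l.get, (List.ofFn_get l).symm⟩

theorem HomCochain.evalList_map {α : g →ₗ[K] g} {n : ℕ} (f : HomCochain α n) (k : ℕ)
    (l : List g) : f.1.evalList (l.map (α ^ k)) = (α ^ k) (f.1.evalList l) := by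
  by_cases h : l.length = n
  · obtain ⟨x, rfl⟩ := List.exists_ofFn_eq h
    rw [List.map_ofFn, AlternatingMap.evalList_ofFn, AlternatingMap.evalList_ofFn]
    induction k with
    | zero => rfl
    | succ k ih =>
      rw [pow_succ', Module.End.mul_apply, ← ih, HomCochain.comm f]
      rfl
  · rw [f.1.evalList_eq_zero h, f.1.evalList_eq_zero (by simpa using h), map_zero]

theorem contraction_evalList (α : g →ₗ[K] g) {m n : ℕ} (P : HomCochain α (m + 1))
    (Q : HomCochain α (n + 1)) (l : List g) :
    (contraction α m n P Q).1.evalList l =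
      unshuffleSum l fun a b => Q.1.evalList (P.1.evalList a :: b.map (α ^ m)) := by
  have hF : ∀ a b : List g, a.length ≠ m + 1 →
      Q.1.evalList (P.1.evalList a :: b.map (α ^ m)) = 0 := by
    intro a b h
    rw [P.1.evalList_eq_zero h, AlternatingMap.evalList_zero_cons]
  by_cases h : l.length = m + n + 1
  · obtain ⟨x, rfl⟩ := List.exists_ofFn_eq h
    have hx : List.ofFn x = List.ofFn fun i => x (Fin.cast (Nat.add_right_comm m 1 n) i) :=
      List.ofFn_congr (Nat.add_right_comm m 1 n).symm x
    rw [AlternatingMap.evalList_ofFn, hx, ← sum_shuffles_eq_unshuffleSum _ hF]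
    refine Finset.sum_congr rfl fun σ _ => ?_
    rw [List.map_ofFn, AlternatingMap.evalList_cons_ofFn, AlternatingMap.evalList_ofFn]
    rfl
  · rw [AlternatingMap.evalList_eq_zero _ h, ← unshuffleSum_zero l]
    refine unshuffleSum_congr fun a b hab => ?_
    by_cases ha : a.length = m + 1
    · rw [AlternatingMap.evalList_eq_zero]
      simp only [List.length_cons, List.length_map]
      omega
    · exact (hF a b ha).symm

theorem cup_evalList (𝔤 : MultHomLieAlgebra K g) {m n : ℕ} (P : HomCochain 𝔤.twist (m + 1))
    (Q : HomCochain 𝔤.twist (n + 1)) (l : List g) :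
    (cup 𝔤 m n P Q).1.evalList l =
      unshuffleSum l fun a b => 𝔤.bracket ((𝔤.twist ^ n) (P.1.evalList a))
        ((𝔤.twist ^ m) (Q.1.evalList b)) := by
  have hF : ∀ a b : List g, a.length ≠ m + 1 →
      𝔤.bracket ((𝔤.twist ^ n) (P.1.evalList a)) ((𝔤.twist ^ m) (Q.1.evalList b)) = 0 := by
    intro a b h
    rw [P.1.evalList_eq_zero h, map_zero, map_zero, LinearMap.zero_apply]
  by_cases h : l.length = (m + 1) + (n + 1)
  · obtain ⟨x, rfl⟩ := List.exists_ofFn_eq h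
    rw [AlternatingMap.evalList_ofFn, ← sum_shuffles_eq_unshuffleSum _ hF]
    refine Finset.sum_congr rfl fun σ _ => ?_
    rw [AlternatingMap.evalList_ofFn, AlternatingMap.evalList_ofFn]
  · rw [AlternatingMap.evalList_eq_zero _ h, ← unshuffleSum_zero l]
    refine unshuffleSum_congr fun a b hab => ?_
    by_cases ha : a.length = m + 1
    · rw [Q.1.evalList_eq_zero (by omega), map_zero, map_zero]
    · exact (hF a b ha).symm

variable [CharZero K]

theorem HomLieAlgebra.bracket_self (𝔤 : HomLieAlgebra K g) (x : g) : 𝔤.bracket x x = 0 := by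
  have h : (2 : K) • 𝔤.bracket x x = 0 := by
    rw [two_smul]
    nth_rewrite 1 [𝔤.skew x x]
    exact neg_add_cancel _
  exact (smul_eq_zero.mp h).resolve_left two_ne_zero

/-- The bracket of a multiplicative Hom-Lie algebra as a cochain of degree `2`. -/
def MultHomLieAlgebra.bracketCochain (𝔤 : MultHomLieAlgebra K g) : HomCochain 𝔤.twist 2 :=
  ⟨{ toFun := fun x => 𝔤.bracket (x 0) (x 1)
     map_update_add' := fun x i a b => by
      refine Fin.cases ?_ (fun i => ?_) i
      · simp
      · obtain rfl := Subsingleton.elim i 0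
        simp
     map_update_smul' := fun x i c a => by
      refine Fin.cases ?_ (fun i => ?_) i
      · simp
      · obtain rfl := Subsingleton.elim i 0
        simp
     map_eq_zero_of_eq' := fun x i j hx hij => by
      have h : x 0 = x 1 := by
        fin_cases i <;> fin_cases j <;> simp_all
      rw [h]
      exact 𝔤.toHomLieAlgebra.bracket_self _ }, fun x => 𝔤.map_bracket _ _⟩

theorem MultHomLieAlgebra.bracketCochain_evalList (𝔤 : MultHomLieAlgebra K g) (x y : g) :
    𝔤.bracketCochain.1.evalList [x, y] = 𝔤.bracket x y := by
  have := 𝔤.bracketCochain.1.evalList_ofFn ![x, y]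
  simpa [bracketCochain] using this

theorem MultHomLieAlgebra.bracketCochain_evalList_cons (𝔤 : MultHomLieAlgebra K g) (x y z : g)
    (l : List g) : 𝔤.bracketCochain.1.evalList (x :: y :: z :: l) = 0 :=
  𝔤.bracketCochain.1.evalList_eq_zero (by simp)

/-- The differential is the Nijenhuis-Richardson bracket with the bracket of `𝔤`, up to sign. -/
theorem differential_evalList (𝔤 : MultHomLieAlgebra K g) {n : ℕ}
    (P : HomCochain 𝔤.twist (n + 1)) (l : List g) :
    (differential 𝔤 n P).1.evalList l =
      (-1 : ℤ) ^ n • (contraction 𝔤.twist n 1 P 𝔤.bracketCochain).1.evalList l -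
        (contraction 𝔤.twist 1 n 𝔤.bracketCochain P).1.evalList l := by
  by_cases h : l.length = n + 2
  · obtain ⟨x, rfl⟩ := List.exists_ofFn_eq h
    rw [AlternatingMap.evalList_ofFn, sub_eq_add_neg, contraction_evalList, contraction_evalList]
    change (_ + _ : g) = _ + _
    congr 1
    · rw [unshuffleSum_comm, ← unshuffleSum_zsmul, ← sum_removeNth_eq_unshuffleSum]
      · refine Finset.sum_congr rfl fun i _ => ?_
        simp only [List.length_ofFn, List.length_singleton, List.map_cons, List.map_nil,
          𝔤.bracketCochain_evalList, AlternatingMap.evalList_ofFn, one_mul, pow_succ]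
        rw [𝔤.skew (P.1 _)]
        simp [smul_smul, ← mul_pow]
      · intro a b ha
        by_cases hb : b.length = n + 1
        · rw [AlternatingMap.evalList_eq_zero, smul_zero, smul_zero]
          simpa using ha
        · rw [P.1.evalList_eq_zero hb, AlternatingMap.evalList_zero_cons, smul_zero, smul_zero]
    · rw [← sum_removeNth_removeNth_eq_unshuffleSum, ← Finset.sum_neg_distrib]
      · refine Finset.sum_congr rfl fun i _ => ?_
        rw [← Finset.sum_neg_distrib]
        refine Finset.sum_congr rfl fun j _ => ?_
        rw [𝔤.bracketCochain_evalList, List.map_ofFn, AlternatingMap.evalList_cons_ofFn, pow_succ,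
          mul_neg_one, neg_smul, pow_one]
        rfl
      · intro a b ha
        rw [𝔤.bracketCochain.1.evalList_eq_zero ha, AlternatingMap.evalList_zero_cons]
  · rw [AlternatingMap.evalList_eq_zero _ h, AlternatingMap.evalList_eq_zero,
      AlternatingMap.evalList_eq_zero] <;> simp <;> omega

end Evaluation

/-! ### Identities between the operations on cochains -/

section Identities

variable {K g : Type*} [Field K] [AddCommGroup g] [Module K g]

theorem pow_apply_pow_apply (α : g →ₗ[K] g) (j k : ℕ) (v : g) :
    (α ^ j) ((α ^ k) v) = (α ^ (j + k)) v := by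
  rw [pow_add, Module.End.mul_apply]

theorem map_pow_map_pow (α : g →ₗ[K] g) (j k : ℕ) (l : List g) :
    (l.map (α ^ j)).map (α ^ k) = l.map (α ^ (j + k)) := by
  rw [List.map_map]
  refine List.map_congr_left fun v _ => ?_
  rw [Function.comp_apply, pow_apply_pow_apply, add_comm]

theorem MultHomLieAlgebra.pow_bracket (𝔤 : MultHomLieAlgebra K g) (k : ℕ) (x y : g) :
    (𝔤.twist ^ k) (𝔤.bracket x y) = 𝔤.bracket ((𝔤.twist ^ k) x) ((𝔤.twist ^ k) y) := by
  induction k with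
  | zero => rfl
  | succ k ih => simp only [pow_succ', Module.End.mul_apply, ih, 𝔤.map_bracket]

theorem unshuffleSum_apply (k : List g) (v : g) (F : List g → List g → g →ₗ[K] g) :
    unshuffleSum k F v = unshuffleSum k fun a b => F a b v :=
  map_unshuffleSum (LinearMap.applyₗ (R := K) v) k F

/-- The values of the simultaneous insertion of `P` and `Q` into two slots of `R`. -/
def doubleInsertion {α : g →ₗ[K] g} {m n r : ℕ} (P : HomCochain α (m + 1))
    (Q : HomCochain α (n + 1)) (R : HomCochain α (r + 1)) (l : List g) : g :=
  unshuffleSum l fun a e => unshuffleSum e fun c d =>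
    R.1.evalList ((α ^ n) (P.1.evalList a) :: (α ^ m) (Q.1.evalList c) :: d.map (α ^ (m + n)))

theorem zsmul_congr_or_zero {N : Type*} [AddCommGroup N] {c d : ℤ} {v : N} {p : Prop}
    (h : p → c = d) (h' : ¬p → v = 0) : c • v = d • v := by
  by_cases hp : p
  · rw [h hp]
  · rw [h' hp, smul_zero, smul_zero]

/-- The associator of the contraction is the double insertion, up to sign: when `P` is inserted
into `i_Q R`, it goes either to a slot of `Q` or to a slot of `R`. -/
theorem contraction_contraction_evalList (α : g →ₗ[K] g) {m n r : ℕ} (P : HomCochain α (m + 1))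
    (Q : HomCochain α (n + 1)) (R : HomCochain α (r + 1)) (l : List g) :
    (contraction α m (n + r) P (contraction α n r Q R)).1.evalList l =
      (contraction α (m + n) r (contraction α m n P Q) R).1.evalList l +
        (-1 : ℤ) ^ n • doubleInsertion P Q R l := by
  rw [contraction_evalList, contraction_evalList, doubleInsertion]
  simp only [contraction_evalList, unshuffleSum_cons, unshuffleSum_map, unshuffleSum_add,
    AlternatingMap.evalList_cons_unshuffleSum]
  rw [unshuffleSum_assoc, ← unshuffleSum_zsmul]
  congr 1
  · simp only [map_pow_map_pow]
  · refine unshuffleSum_congr fun a e _ => ?_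
    rw [← unshuffleSum_zsmul]
    refine unshuffleSum_congr fun c d _ => ?_
    rw [List.map_cons, map_pow_map_pow, HomCochain.evalList_map, List.length_map,
      AlternatingMap.evalList_swap_head, smul_neg, ← neg_smul, ← neg_one_mul, ← pow_succ']
    refine zsmul_congr_or_zero (p := c.length = n + 1) (fun h => ?_) (fun h => ?_)
    · rw [h, pow_succ, pow_succ]
      ring
    · rw [Q.1.evalList_eq_zero h, map_zero, AlternatingMap.evalList_cons_zero_cons]

/-- The double insertion is graded symmetric. -/
theorem doubleInsertion_comm {α : g →ₗ[K] g} {m n r : ℕ} (P : HomCochain α (m + 1))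
    (Q : HomCochain α (n + 1)) (R : HomCochain α (r + 1)) (l : List g) :
    doubleInsertion P Q R l = (-1 : ℤ) ^ ((m + 1) * (n + 1) + 1) • doubleInsertion Q P R l := by
  rw [doubleInsertion, doubleInsertion, ← unshuffleSum_assoc, ← unshuffleSum_assoc,
    ← unshuffleSum_zsmul]
  refine unshuffleSum_congr fun e d _ => ?_
  rw [unshuffleSum_comm, ← unshuffleSum_zsmul]
  refine unshuffleSum_congr fun a c _ => ?_
  rw [AlternatingMap.evalList_swap_head, add_comm n m, smul_neg, ← neg_smul, ← neg_one_mul,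
    ← pow_succ']
  by_cases ha : a.length = n + 1
  · by_cases hc : c.length = m + 1
    · rw [ha, hc, mul_comm]
    · rw [P.1.evalList_eq_zero hc, map_zero, AlternatingMap.evalList_cons_zero_cons, smul_zero,
        smul_zero]
  · rw [Q.1.evalList_eq_zero ha, map_zero, AlternatingMap.evalList_zero_cons, smul_zero,
      smul_zero]

/-- The cup bracket is the double insertion into the bracket of `𝔤`. -/
theorem doubleInsertion_bracketCochain [CharZero K] (𝔤 : MultHomLieAlgebra K g) {m n : ℕ}
    (P : HomCochain 𝔤.twist (m + 1)) (Q : HomCochain 𝔤.twist (n + 1)) (l : List g) :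
    doubleInsertion P Q 𝔤.bracketCochain l = (cup 𝔤 m n P Q).1.evalList l := by
  rw [doubleInsertion, cup_evalList]
  refine unshuffleSum_congr fun a e _ => ?_
  rw [unshuffleSum_eq_of_right_nil, List.map_nil, 𝔤.bracketCochain_evalList]
  intro c d hd
  cases d with
  | nil => exact absurd rfl hd
  | cons x d => exact 𝔤.bracketCochain_evalList_cons _ _ _ _

/-- The Hom-Jacobi identity: the bracket of `𝔤`, as a cochain, has square zero for the
contraction. -/
theorem contraction_bracketCochain_evalList [CharZero K] (𝔤 : MultHomLieAlgebra K g)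
    (l : List g) :
    (contraction 𝔤.twist 1 1 𝔤.bracketCochain 𝔤.bracketCochain).1.evalList l = 0 := by
  by_cases h : l.length = 3
  · obtain ⟨x, y, z, rfl⟩ := List.length_eq_three.mp h
    have hz : ∀ v : g, 𝔤.bracketCochain.1.evalList [v] = 0 := fun v =>
      𝔤.bracketCochain.1.evalList_eq_zero (by simp)
    have hn : 𝔤.bracketCochain.1.evalList [] = 0 := 𝔤.bracketCochain.1.evalList_eq_zero (by simp)
    rw [contraction_evalList]
    simp [unshuffleSum, 𝔤.bracketCochain_evalList, 𝔤.bracketCochain_evalList_cons, hz, hn]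
    have := 𝔤.hom_jacobi x y z
    rw [𝔤.skew z x, map_neg, 𝔤.skew (𝔤.twist x), 𝔤.skew (𝔤.twist y),
      𝔤.skew (𝔤.twist z)] at this
    rw [← neg_eq_zero, ← this]
    abel
  · exact AlternatingMap.evalList_eq_zero _ h

theorem cup_comm_evalList (𝔤 : MultHomLieAlgebra K g) {m n : ℕ} (P : HomCochain 𝔤.twist (m + 1))
    (Q : HomCochain 𝔤.twist (n + 1)) (l : List g) :
    (cup 𝔤 m n P Q).1.evalList l =
      -((-1 : ℤ) ^ ((m + 1) * (n + 1)) • (cup 𝔤 n m Q P).1.evalList l) := by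
  rw [cup_evalList, cup_evalList, unshuffleSum_comm, ← unshuffleSum_zsmul, ← unshuffleSum_neg]
  refine unshuffleSum_congr fun a b _ => ?_
  rw [𝔤.skew, smul_neg, neg_inj]
  by_cases ha : a.length = n + 1
  · by_cases hb : b.length = m + 1
    · rw [ha, hb, mul_comm]
    · simp [P.1.evalList_eq_zero hb]
  · simp [Q.1.evalList_eq_zero ha]

/-- Contractions act on the cup bracket by graded derivations: `P` is inserted into one of the two
factors. -/
theorem contraction_cup_evalList (𝔤 : MultHomLieAlgebra K g) {m n r : ℕ}
    (P : HomCochain 𝔤.twist (m + 1)) (Q : HomCochain 𝔤.twist (n + 1))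
    (R : HomCochain 𝔤.twist (r + 1)) (l : List g) :
    (contraction 𝔤.twist m (n + 1 + r) P (cup 𝔤 n r Q R)).1.evalList l =
      (cup 𝔤 (m + n) r (contraction 𝔤.twist m n P Q) R).1.evalList l +
        (-1 : ℤ) ^ (m * (n + 1)) •
          (cup 𝔤 n (m + r) Q (contraction 𝔤.twist m r P R)).1.evalList l := by
  rw [contraction_evalList, cup_evalList, cup_evalList]
  have hc : ∀ k : List g, (cup 𝔤 n r Q R).1.evalList k =
      unshuffleSum k fun a b => 𝔤.bracket ((𝔤.twist ^ r) (Q.1.evalList a))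
        ((𝔤.twist ^ n) (R.1.evalList b)) := cup_evalList 𝔤 Q R
  simp only [contraction_evalList, hc, map_unshuffleSum, unshuffleSum_apply, unshuffleSum_cons,
    unshuffleSum_map, unshuffleSum_add]
  rw [unshuffleSum_assoc]
  congr 1
  · simp only [HomCochain.evalList_map, pow_apply_pow_apply, add_comm n m]
  · rw [← unshuffleSum_zsmul, ← unshuffleSum_assoc]
    simp only [← unshuffleSum_zsmul]
    rw [← unshuffleSum_assoc]
    refine unshuffleSum_congr fun e d _ => ?_
    rw [unshuffleSum_comm]
    refine unshuffleSum_congr fun c a _ => ?_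
    rw [List.length_map, HomCochain.evalList_map, pow_apply_pow_apply, add_comm r m, smul_smul,
      ← pow_add]
    by_cases hc : c.length = n + 1
    · by_cases ha : a.length = m + 1
      · congr 1
        rw [hc, ha, show (n + 1) * (m + 1) + (n + 1) = m * (n + 1) + ((n + 1) + (n + 1)) by ring,
          pow_add _ _ ((n + 1) + (n + 1)), Even.neg_one_pow (Even.add_self _), mul_one]
      · simp [P.1.evalList_eq_zero ha, AlternatingMap.evalList_zero_cons]
    · simp [Q.1.evalList_eq_zero hc]

/-- The graded Jacobi identity of the cup bracket. -/
theorem cup_cup_evalList (𝔤 : MultHomLieAlgebra K g) {m n r : ℕ}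
    (P : HomCochain 𝔤.twist (m + 1)) (Q : HomCochain 𝔤.twist (n + 1))
    (R : HomCochain 𝔤.twist (r + 1)) (l : List g) :
    (cup 𝔤 m (n + 1 + r) P (cup 𝔤 n r Q R)).1.evalList l =
      (cup 𝔤 (m + 1 + n) r (cup 𝔤 m n P Q) R).1.evalList l +
        (-1 : ℤ) ^ ((m + 1) * (n + 1)) •
          (cup 𝔤 n (m + 1 + r) Q (cup 𝔤 m r P R)).1.evalList l := by
  rw [cup_evalList, cup_evalList, cup_evalList]
  have hc : ∀ {m n : ℕ} (P : HomCochain 𝔤.twist (m + 1)) (Q : HomCochain 𝔤.twist (n + 1))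
      (k : List g), AlternatingMap.evalList (n := m + 1 + n + 1) (cup 𝔤 m n P Q).1 k =
      unshuffleSum k fun a b => 𝔤.bracket ((𝔤.twist ^ n) (P.1.evalList a))
        ((𝔤.twist ^ m) (Q.1.evalList b)) := fun P Q => cup_evalList 𝔤 P Q
  simp only [hc, map_unshuffleSum, unshuffleSum_apply, 𝔤.pow_bracket, pow_apply_pow_apply]
  have hcomm : (unshuffleSum l fun c e => unshuffleSum e fun a d =>
      𝔤.bracket ((𝔤.twist ^ (m + 1 + r)) (Q.1.evalList c))
        (𝔤.bracket ((𝔤.twist ^ (n + r)) (P.1.evalList a))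
          ((𝔤.twist ^ (n + m)) (R.1.evalList d)))) =
      unshuffleSum l fun e d => unshuffleSum e fun a c => (-1 : ℤ) ^ (a.length * c.length) •
        𝔤.bracket ((𝔤.twist ^ (m + 1 + r)) (Q.1.evalList c))
          (𝔤.bracket ((𝔤.twist ^ (n + r)) (P.1.evalList a))
            ((𝔤.twist ^ (n + m)) (R.1.evalList d))) := by
    rw [← unshuffleSum_assoc]
    exact unshuffleSum_congr fun e d _ => unshuffleSum_comm e _
  rw [hcomm, ← unshuffleSum_assoc, ← unshuffleSum_zsmul, ← unshuffleSum_add]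
  refine unshuffleSum_congr fun e d _ => ?_
  rw [← unshuffleSum_zsmul, ← unshuffleSum_add]
  refine unshuffleSum_congr fun a c _ => ?_
  have key : ∀ x y z : g,
      𝔤.bracket (𝔤.twist x) (𝔤.bracket y z) = 𝔤.bracket (𝔤.bracket x y) (𝔤.twist z) +
        𝔤.bracket (𝔤.twist y) (𝔤.bracket x z) := by
    intro x y z
    have := 𝔤.hom_jacobi x y z
    rw [𝔤.skew z x, map_neg, 𝔤.skew (𝔤.twist z)] at this
    rw [← sub_eq_zero, ← this]
    abel
  have hk := key ((𝔤.twist ^ (n + r)) (P.1.evalList a)) ((𝔤.twist ^ (m + r)) (Q.1.evalList c))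
    ((𝔤.twist ^ (m + n)) (R.1.evalList d))
  have hp : ∀ (k : ℕ) (v : g), 𝔤.twist ((𝔤.twist ^ k) v) = (𝔤.twist ^ (k + 1)) v := by
    intro k v
    rw [pow_succ', Module.End.mul_apply]
  simp only [hp] at hk
  rw [add_right_comm n 1 r, hk, add_comm r n, add_comm r m, add_right_comm m 1 n,
    add_right_comm m 1 r, add_comm n m, smul_smul]
  congr 1
  by_cases ha : a.length = m + 1
  · by_cases hc : c.length = n + 1
    · rw [ha, hc, ← pow_add, Even.neg_one_pow (Even.add_self _), one_smul]
    · simp [Q.1.evalList_eq_zero hc]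
  · simp [P.1.evalList_eq_zero ha]

end Identities

/-! ### The Frölicher-Nijenhuis bracket of a pre-Lie algebra with a quadratic element -/

section Abstract

variable {K L : Type*} [Field K] [AddCommGroup L] [Module K L]

/-- A left graded pre-Lie product `dot`, a graded Lie bracket `C` of degree `1`, on which the
pre-Lie algebra acts by graded derivations, and an element `μ` of degree `1` with `μ · μ = 0` such
that `C` is, up to sign, the associator with `μ` as last argument. The degrees are those for which
`dot` has degree `0`, so that an element of `𝒜 n` has degree `n + 1` for the Lie bracket `C`. -/
structure IsPreLieCup (𝒜 : ℕ → Submodule K L) (dot C : L →ₗ[K] L →ₗ[K] L) (μ : L) : Prop where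
  dot_mem : ∀ {m n : ℕ} {x y : L}, x ∈ 𝒜 m → y ∈ 𝒜 n → dot x y ∈ 𝒜 (m + n)
  preLie : ∀ {m n r : ℕ} {x y z : L}, x ∈ 𝒜 m → y ∈ 𝒜 n → z ∈ 𝒜 r →
    dot x (dot y z) - dot (dot x y) z =
      (-1 : ℤ) ^ (m * n) • (dot y (dot x z) - dot (dot y x) z)
  mu_mem : μ ∈ 𝒜 1
  mu_mu : dot μ μ = 0
  dot_dot_mu : ∀ {m n : ℕ} {x y : L}, x ∈ 𝒜 m → y ∈ 𝒜 n →
    dot x (dot y μ) = dot (dot x y) μ + (-1 : ℤ) ^ n • C x y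
  cup_mem : ∀ {m n : ℕ} {x y : L}, x ∈ 𝒜 m → y ∈ 𝒜 n → C x y ∈ 𝒜 (m + n + 1)
  cup_skew : ∀ {m n : ℕ} {x y : L}, x ∈ 𝒜 m → y ∈ 𝒜 n →
    C x y = -((-1 : ℤ) ^ ((m + 1) * (n + 1)) • C y x)
  cup_jacobi : ∀ {m n r : ℕ} {x y z : L}, x ∈ 𝒜 m → y ∈ 𝒜 n → z ∈ 𝒜 r →
    C x (C y z) = C (C x y) z + (-1 : ℤ) ^ ((m + 1) * (n + 1)) • C y (C x z)
  dot_cup : ∀ {m n r : ℕ} {x y z : L}, x ∈ 𝒜 m → y ∈ 𝒜 n → z ∈ 𝒜 r →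
    dot x (C y z) = C (dot x y) z + (-1 : ℤ) ^ (m * (n + 1)) • C y (dot x z)

/-- The bilinear map `nr` is, on homogeneous elements, the graded commutator of `dot`. -/
def IsGradedCommutator (𝒜 : ℕ → Submodule K L) (dot nr : L →ₗ[K] L →ₗ[K] L) : Prop :=
  ∀ ⦃m n : ℕ⦄ ⦃x y : L⦄, x ∈ 𝒜 m → y ∈ 𝒜 n →
    nr x y = dot x y - (-1 : ℤ) ^ (m * n) • dot y x

/-- The linear map `δ` is minus the graded commutator with `μ`. -/
def IsInnerDifferential (𝒜 : ℕ → Submodule K L) (dot : L →ₗ[K] L →ₗ[K] L) (μ : L)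
    (δ : L →ₗ[K] L) : Prop :=
  ∀ ⦃m : ℕ⦄ ⦃x : L⦄, x ∈ 𝒜 m → δ x = (-1 : ℤ) ^ m • dot x μ - dot μ x

/-- The bilinear map `fn` is the bracket of Frölicher-Nijenhuis type built from `C`, `dot` and
`δ`. -/
def IsFrolicherNijenhuis (𝒜 : ℕ → Submodule K L) (dot C : L →ₗ[K] L →ₗ[K] L) (δ : L →ₗ[K] L)
    (fn : L →ₗ[K] L →ₗ[K] L) : Prop :=
  ∀ ⦃m n : ℕ⦄ ⦃x y : L⦄, x ∈ 𝒜 m → y ∈ 𝒜 n →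
    fn x y = C x y + (-1 : ℤ) ^ (m + 1) • dot (δ x) y -
      (-1 : ℤ) ^ ((m + 1 + 1) * (n + 1)) • dot (δ y) x

namespace IsPreLieCup

variable {𝒜 : ℕ → Submodule K L} {dot C nr fn : L →ₗ[K] L →ₗ[K] L} {μ : L} {δ : L →ₗ[K] L}

theorem commutator_mem (h : IsPreLieCup 𝒜 dot C μ) (hnr : IsGradedCommutator 𝒜 dot nr)
    {m n : ℕ} {x y : L} (hx : x ∈ 𝒜 m) (hy : y ∈ 𝒜 n) : nr x y ∈ 𝒜 (m + n) := by
  rw [hnr hx hy]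
  exact sub_mem (h.dot_mem hx hy) (zsmul_mem (add_comm n m ▸ h.dot_mem hy hx) _)

theorem commutator_skew (hnr : IsGradedCommutator 𝒜 dot nr)
    {m n : ℕ} {x y : L} (hx : x ∈ 𝒜 m) (hy : y ∈ 𝒜 n) :
    nr x y = -((-1 : ℤ) ^ (m * n) • nr y x) := by
  rw [hnr hx hy, hnr hy hx, mul_comm n m]
  rcases neg_one_pow_eq_or ℤ (m * n) with h | h <;> rw [h] <;> module

/-- The graded commutator of a graded pre-Lie product satisfies the graded Jacobi identity. -/
theorem commutator_jacobi (h : IsPreLieCup 𝒜 dot C μ) (hnr : IsGradedCommutator 𝒜 dot nr)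
    {m n r : ℕ} {x y z : L} (hx : x ∈ 𝒜 m) (hy : y ∈ 𝒜 n) (hz : z ∈ 𝒜 r) :
    nr x (nr y z) = nr (nr x y) z + (-1 : ℤ) ^ (m * n) • nr y (nr x z) := by
  have h1 := h.preLie hx hy hz
  have h2 := h.preLie hx hz hy
  have h3 := h.preLie hy hz hx
  rw [hnr hy hz, hnr hx hy, hnr hx hz]
  simp only [map_sub, map_zsmul, LinearMap.sub_apply, LinearMap.smul_apply,
    hnr hx (h.dot_mem hy hz), hnr hx (h.dot_mem hz hy), hnr hy (h.dot_mem hx hz),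
    hnr hy (h.dot_mem hz hx), hnr (h.dot_mem hx hy) hz, hnr (h.dot_mem hy hx) hz,
    mul_add, add_mul, pow_add, mul_comm n m]
  rcases neg_one_pow_eq_or ℤ (m * n) with hu | hu <;>
  rcases neg_one_pow_eq_or ℤ (m * r) with hv | hv <;>
  rcases neg_one_pow_eq_or ℤ (n * r) with hw | hw <;>
  linear_combination (norm := (simp only [hu, hv, hw]; module))
    h1 - (-1 : ℤ) ^ (n * r) • h2 + ((-1 : ℤ) ^ (m * n) * (-1 : ℤ) ^ (m * r)) • h3

theorem delta_mem (h : IsPreLieCup 𝒜 dot C μ) (hδ : IsInnerDifferential 𝒜 dot μ δ)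
    {m : ℕ} {x : L} (hx : x ∈ 𝒜 m) : δ x ∈ 𝒜 (m + 1) := by
  rw [hδ hx]
  exact sub_mem (zsmul_mem (h.dot_mem hx h.mu_mem) _) (add_comm 1 m ▸ h.dot_mem h.mu_mem hx)

theorem delta_eq (h : IsPreLieCup 𝒜 dot C μ) (hnr : IsGradedCommutator 𝒜 dot nr)
    (hδ : IsInnerDifferential 𝒜 dot μ δ) {m : ℕ} {x : L} (hx : x ∈ 𝒜 m) :
    δ x = -nr μ x := by
  rw [hδ hx, hnr h.mu_mem hx, one_mul, neg_sub]

theorem delta_commutator (h : IsPreLieCup 𝒜 dot C μ) (hnr : IsGradedCommutator 𝒜 dot nr)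
    (hδ : IsInnerDifferential 𝒜 dot μ δ) {m n : ℕ} {x y : L} (hx : x ∈ 𝒜 m) (hy : y ∈ 𝒜 n) :
    δ (nr x y) = nr (δ x) y + (-1 : ℤ) ^ m • nr x (δ y) := by
  rw [h.delta_eq hnr hδ (h.commutator_mem hnr hx hy), h.delta_eq hnr hδ hx,
    h.delta_eq hnr hδ hy, h.commutator_jacobi hnr h.mu_mem hx hy, one_mul]
  simp only [map_neg, LinearMap.neg_apply, smul_neg]
  abel

/-- The differential has square zero, by the Jacobi identity for `μ, μ, x` and `[μ, μ] = 0`. -/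
theorem delta_delta [CharZero K] (h : IsPreLieCup 𝒜 dot C μ) (hnr : IsGradedCommutator 𝒜 dot nr)
    (hδ : IsInnerDifferential 𝒜 dot μ δ) {m : ℕ} {x : L} (hx : x ∈ 𝒜 m) : δ (δ x) = 0 := by
  have hμ : nr μ μ = 0 := by
    rw [hnr h.mu_mem h.mu_mem, h.mu_mu, smul_zero, sub_zero]
  have hj := h.commutator_jacobi hnr h.mu_mem h.mu_mem hx
  rw [hμ, map_zero, LinearMap.zero_apply, zero_add, one_mul, pow_one, neg_one_smul] at hj
  have h2 : (2 : K) • nr μ (nr μ x) = 0 := by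
    rw [two_smul]
    nth_rewrite 1 [hj]
    exact neg_add_cancel _
  rw [h.delta_eq hnr hδ (h.delta_mem hδ hx), h.delta_eq hnr hδ hx, map_neg, neg_neg]
  exact (smul_eq_zero.mp h2).resolve_left two_ne_zero

theorem fn_mem (h : IsPreLieCup 𝒜 dot C μ) (hδ : IsInnerDifferential 𝒜 dot μ δ)
    (hfn : IsFrolicherNijenhuis 𝒜 dot C δ fn) {m n : ℕ} {x y : L} (hx : x ∈ 𝒜 m)
    (hy : y ∈ 𝒜 n) : fn x y ∈ 𝒜 (m + n + 1) := by
  rw [hfn hx hy]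
  refine sub_mem (add_mem (h.cup_mem hx hy) (zsmul_mem ?_ _)) (zsmul_mem ?_ _)
  · exact add_right_comm m 1 n ▸ h.dot_mem (h.delta_mem hδ hx) hy
  · have := h.dot_mem (h.delta_mem hδ hy) hx
    rwa [show n + 1 + m = m + n + 1 by ring] at this

/-- The bracket `fn` is a coboundary up to a commutator with a coboundary. -/
theorem fn_eq_delta (h : IsPreLieCup 𝒜 dot C μ) (hnr : IsGradedCommutator 𝒜 dot nr)
    (hδ : IsInnerDifferential 𝒜 dot μ δ) (hfn : IsFrolicherNijenhuis 𝒜 dot C δ fn) {m n : ℕ}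
    {x y : L} (hx : x ∈ 𝒜 m) (hy : y ∈ 𝒜 n) :
    fn x y = nr x (δ y) - (-1 : ℤ) ^ m • δ (dot x y) := by
  have h1 := h.preLie h.mu_mem hx hy
  have h2 := h.dot_dot_mu hx hy
  rw [hfn hx hy, hnr hx (h.delta_mem hδ hy), hδ (h.dot_mem hx hy), hδ hx, hδ hy,
    show (m + 1 + 1) * (n + 1) = m * n + m + (n + 1) + (n + 1) by ring]
  simp only [map_sub, map_zsmul, LinearMap.sub_apply, LinearMap.smul_apply, mul_add, one_mul,
    mul_one, pow_add, pow_one] at h1 ⊢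
  rcases neg_one_pow_eq_or ℤ (m * n) with hu | hu <;>
  rcases neg_one_pow_eq_or ℤ m with ha | ha <;>
  rcases neg_one_pow_eq_or ℤ n with hb | hb <;>
  linear_combination (norm := (simp only [hu, ha, hb]; module))
    (-(-1 : ℤ) ^ m) • h1 - (-1 : ℤ) ^ n • h2

theorem delta_fn [CharZero K] (h : IsPreLieCup 𝒜 dot C μ) (hnr : IsGradedCommutator 𝒜 dot nr)
    (hδ : IsInnerDifferential 𝒜 dot μ δ) (hfn : IsFrolicherNijenhuis 𝒜 dot C δ fn) {m n : ℕ}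
    {x y : L} (hx : x ∈ 𝒜 m) (hy : y ∈ 𝒜 n) : δ (fn x y) = nr (δ x) (δ y) := by
  rw [h.fn_eq_delta hnr hδ hfn hx hy, map_sub, map_zsmul, h.delta_delta hnr hδ (h.dot_mem hx hy),
    h.delta_commutator hnr hδ hx (h.delta_mem hδ hy), h.delta_delta hnr hδ hy]
  simp

theorem fn_skew (h : IsPreLieCup 𝒜 dot C μ) (hfn : IsFrolicherNijenhuis 𝒜 dot C δ fn) {m n : ℕ}
    {x y : L} (hx : x ∈ 𝒜 m) (hy : y ∈ 𝒜 n) :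
    fn x y = -((-1 : ℤ) ^ ((m + 1) * (n + 1)) • fn y x) := by
  rw [hfn hx hy, hfn hy hx, h.cup_skew hx hy]
  simp only [mul_add, add_mul, one_mul, mul_one, pow_add, pow_one, mul_comm n m]
  rcases neg_one_pow_eq_or ℤ (m * n) with hu | hu <;>
  rcases neg_one_pow_eq_or ℤ m with ha | ha <;>
  rcases neg_one_pow_eq_or ℤ n with hb | hb <;>
  simp only [hu, ha, hb] <;> module

/-- The graded Jacobi identity of `fn`: the map `x ↦ (x, ±δ x)` embeds `fn` into the semidirect
product of the Lie algebra `C` with the Lie algebra `nr`, which acts on it by `dot`. -/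
theorem fn_jacobi [CharZero K] (h : IsPreLieCup 𝒜 dot C μ) (hnr : IsGradedCommutator 𝒜 dot nr)
    (hδ : IsInnerDifferential 𝒜 dot μ δ) (hfn : IsFrolicherNijenhuis 𝒜 dot C δ fn) {m n r : ℕ}
    {x y z : L} (hx : x ∈ 𝒜 m) (hy : y ∈ 𝒜 n) (hz : z ∈ 𝒜 r) :
    fn x (fn y z) = fn (fn x y) z + (-1 : ℤ) ^ ((m + 1) * (n + 1)) • fn y (fn x z) := by
  -- The signs `(-1) ^ (m + 1)` are absorbed into `δ` to get the bracket of the semidirect product.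
  have hfn' : ∀ {m n : ℕ} {x y : L}, x ∈ 𝒜 m → y ∈ 𝒜 n →
      fn x y = C x y + dot ((-1 : ℤ) ^ (m + 1) • δ x) y -
        (-1 : ℤ) ^ ((m + 1) * (n + 1)) • dot ((-1 : ℤ) ^ (n + 1) • δ y) x := by
    intro m n x y hx hy
    rw [hfn hx hy, map_zsmul, map_zsmul, LinearMap.smul_apply, LinearMap.smul_apply, smul_smul,
      ← pow_add, add_one_mul (m + 1) (n + 1)]
  have hD : ∀ {m n : ℕ} {x y : L}, x ∈ 𝒜 m → y ∈ 𝒜 n →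
      (-1 : ℤ) ^ (m + n + 1 + 1) • δ (fn x y) =
        nr ((-1 : ℤ) ^ (m + 1) • δ x) ((-1 : ℤ) ^ (n + 1) • δ y) := by
    intro m n x y hx hy
    rw [h.delta_fn hnr hδ hfn hx hy, map_zsmul, map_zsmul, LinearMap.smul_apply, smul_smul,
      ← pow_add]
    congr 2
    ring
  have hact : ∀ {m n r : ℕ} {x y z : L}, x ∈ 𝒜 m → y ∈ 𝒜 n → z ∈ 𝒜 r →
      dot (nr x y) z = dot x (dot y z) - (-1 : ℤ) ^ (m * n) • dot y (dot x z) := by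
    intro m n r x y z hx hy hz
    have := h.preLie hx hy hz
    rw [hnr hx hy, map_sub, map_zsmul, LinearMap.sub_apply, LinearMap.smul_apply]
    linear_combination (norm := module) -this
  have hmem : ∀ {m : ℕ} {x : L}, x ∈ 𝒜 m → (-1 : ℤ) ^ (m + 1) • δ x ∈ 𝒜 (m + 1) :=
    fun hx => zsmul_mem (h.delta_mem hδ hx) _
  rw [hfn' hx (h.fn_mem hδ hfn hy hz), hfn' (h.fn_mem hδ hfn hx hy) hz,
    hfn' hy (h.fn_mem hδ hfn hx hz), hD hy hz, hD hx hy, hD hx hz, hfn' hx hy, hfn' hy hz,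
    hfn' hx hz]
  have hx' := hmem hx
  have hy' := hmem hy
  have hz' := hmem hz
  -- From here on, only the actions of `δ x`, `δ y` and `δ z` matter, not their definition.
  generalize (-1 : ℤ) ^ (m + 1) • δ x = x' at *
  generalize (-1 : ℤ) ^ (n + 1) • δ y = y' at *
  generalize (-1 : ℤ) ^ (r + 1) • δ z = z' at *
  have hj := h.cup_jacobi hx hy hz
  have hdx := h.dot_cup hx' hy hz
  have hdy := h.dot_cup hy' hx hz
  have hdz := h.dot_cup hz' hx hy
  have hsk := h.cup_skew (h.dot_mem hz' hx) hy
  have hxy := hact hx' hy' hz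
  have hxz := hact hx' hz' hy
  have hyz := hact hy' hz' hx
  have e1 : (-1 : ℤ) ^ ((m + 1) * (n + r + 1 + 1)) =
      (-1) ^ ((m + 1) * (n + 1)) * (-1) ^ ((m + 1) * (r + 1)) := by
    rw [← pow_add]
    congr 1
    ring
  have e2 : (-1 : ℤ) ^ ((m + n + 1 + 1) * (r + 1)) =
      (-1) ^ ((m + 1) * (r + 1)) * (-1) ^ ((n + 1) * (r + 1)) := by
    rw [← pow_add]
    congr 1
    ring
  have e3 : (-1 : ℤ) ^ ((n + 1) * (m + r + 1 + 1)) =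
      (-1) ^ ((m + 1) * (n + 1)) * (-1) ^ ((n + 1) * (r + 1)) := by
    rw [← pow_add]
    congr 1
    ring
  have e4 : (-1 : ℤ) ^ ((r + 1 + m + 1) * (n + 1)) =
      (-1) ^ ((m + 1) * (n + 1)) * (-1) ^ ((n + 1) * (r + 1)) := by
    rw [← pow_add]
    congr 1
    ring
  rw [mul_comm (n + 1)] at hdy
  rw [mul_comm (r + 1)] at hdz
  rw [e4] at hsk
  simp only [e1, e2, e3, map_sub, map_add, map_zsmul, LinearMap.sub_apply, LinearMap.add_apply,
    LinearMap.smul_apply]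
  rcases neg_one_pow_eq_or ℤ ((m + 1) * (n + 1)) with hu | hu <;>
  rcases neg_one_pow_eq_or ℤ ((m + 1) * (r + 1)) with hv | hv <;>
  rcases neg_one_pow_eq_or ℤ ((n + 1) * (r + 1)) with hw | hw <;>
  linear_combination (norm := (simp only [hu, hv, hw]; module))
    hj + hdx - (-1 : ℤ) ^ ((m + 1) * (n + 1)) • hdy +
      ((-1 : ℤ) ^ ((m + 1) * (r + 1)) * (-1 : ℤ) ^ ((n + 1) * (r + 1))) • (hdz + hsk) - hxy +
      (-1 : ℤ) ^ ((n + 1) * (r + 1)) • hxz -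
      ((-1 : ℤ) ^ ((m + 1) * (n + 1)) * (-1 : ℤ) ^ ((m + 1) * (r + 1))) • hyz

end IsPreLieCup

end Abstract

/-! ### The graded space of cochains -/

section DirectSumOfCochains

variable {K g : Type*} [Field K] [AddCommGroup g] [Module K g]

namespace Cochains

/-- The values on lists of an element of `C^•_Hom(g, g)`. -/
def evalList (α : g →ₗ[K] g) : Cochains α →ₗ[K] (List g → g) :=
  DirectSum.toModule K ℕ _ fun _ =>
    { toFun := fun P l => P.1.evalList l
      map_add' := fun P Q => funext fun l => P.1.evalList_add Q.1 l
      map_smul' := fun c P => funext fun l => P.1.evalList_smul c l }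

theorem evalList_of (α : g →ₗ[K] g) {n : ℕ} (P : HomCochain α (n + 1)) (l : List g) :
    evalList α (of α n P) l = P.1.evalList l := by
  rw [evalList, DirectSum.toModule_lof]
  rfl

theorem evalList_ofFn (α : g →ₗ[K] g) (P : Cochains α) {n : ℕ} (x : Fin (n + 1) → g) :
    evalList α P (List.ofFn x) = (P n).1 x := by
  induction P using DirectSum.induction_on with
  | zero => simp
  | of m P =>
    refine (evalList_of α P _).trans ?_
    by_cases h : m = n
    · subst h
      rw [DirectSum.of_eq_same, AlternatingMap.evalList_ofFn]
    · rw [DirectSum.of_eq_of_ne _ _ _ (Ne.symm h), AlternatingMap.evalList_eq_zero]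
      · rfl
      · simpa using Ne.symm h
  | add P Q hP hQ =>
    rw [map_add, Pi.add_apply, hP, hQ]
    rfl

theorem evalList_injective (α : g →ₗ[K] g) : Function.Injective (evalList α) := by
  intro P Q h
  ext n x
  rw [← evalList_ofFn, ← evalList_ofFn, h]

theorem bilinear_of (α : g →ₗ[K] g)
    (B : ∀ m n : ℕ, HomCochain α (m + 1) →ₗ[K] HomCochain α (n + 1) →ₗ[K] Cochains α) {m n : ℕ}
    (P : HomCochain α (m + 1)) (Q : HomCochain α (n + 1)) :
    bilinear α B (of α m P) (of α n Q) = B m n P Q := by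
  rw [bilinear, DirectSum.toModule_lof, LinearMap.flip_apply, DirectSum.toModule_lof,
    LinearMap.flip_apply]

/-- The contraction, extended bilinearly to `C^•_Hom(g, g)`. -/
def dot (α : g →ₗ[K] g) : Cochains α →ₗ[K] Cochains α →ₗ[K] Cochains α :=
  bilinear α fun m n => (contraction α m n).compr₂ (of α (m + n))

/-- The cup product bracket, extended bilinearly to `C^•_Hom(g, g)`. -/
def cupBracket (𝔤 : MultHomLieAlgebra K g) :
    Cochains 𝔤.twist →ₗ[K] Cochains 𝔤.twist →ₗ[K] Cochains 𝔤.twist :=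
  bilinear 𝔤.twist fun m n => (cup 𝔤 m n).compr₂ (of 𝔤.twist (m + 1 + n))

theorem dot_of (α : g →ₗ[K] g) {m n : ℕ} (P : HomCochain α (m + 1)) (Q : HomCochain α (n + 1)) :
    dot α (of α m P) (of α n Q) = of α (m + n) (contraction α m n P Q) :=
  bilinear_of α _ P Q

theorem cupBracket_of (𝔤 : MultHomLieAlgebra K g) {m n : ℕ} (P : HomCochain 𝔤.twist (m + 1))
    (Q : HomCochain 𝔤.twist (n + 1)) :
    cupBracket 𝔤 (of 𝔤.twist m P) (of 𝔤.twist n Q) = of 𝔤.twist (m + 1 + n) (cup 𝔤 m n P Q) :=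
  bilinear_of 𝔤.twist _ P Q

/-- The summand `C^{n+1}_Hom(g, g)` of `C^•_Hom(g, g)`. -/
def piece (α : g →ₗ[K] g) (n : ℕ) : Submodule K (Cochains α) := LinearMap.range (of α n)

theorem of_mem_piece (α : g →ₗ[K] g) {m n : ℕ} (h : m = n) (P : HomCochain α (m + 1)) :
    of α m P ∈ piece α n := by
  subst h
  exact ⟨P, rfl⟩

/-- The cochains form an algebraic structure to which the results on the Frölicher-Nijenhuis
bracket apply. -/
theorem isPreLieCup [CharZero K] (𝔤 : MultHomLieAlgebra K g) :
    IsPreLieCup (piece 𝔤.twist) (dot 𝔤.twist) (cupBracket 𝔤)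
      (of 𝔤.twist 1 𝔤.bracketCochain) where
  dot_mem := by
    rintro m n _ _ ⟨P, rfl⟩ ⟨Q, rfl⟩
    rw [dot_of]
    exact of_mem_piece _ rfl _
  preLie := by
    rintro m n r _ _ _ ⟨P, rfl⟩ ⟨Q, rfl⟩ ⟨R, rfl⟩
    refine evalList_injective _ (funext fun l => ?_)
    simp only [dot_of, map_sub, map_zsmul, Pi.sub_apply, Pi.smul_apply, evalList_of,
      contraction_contraction_evalList, add_sub_cancel_left]
    rw [doubleInsertion_comm P Q, smul_smul, smul_smul, ← pow_add, ← pow_add,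
      show n + ((m + 1) * (n + 1) + 1) = m * n + m + ((n + 1) + (n + 1)) by ring,
      pow_add _ _ ((n + 1) + (n + 1)), Even.neg_one_pow (Even.add_self _), mul_one]
  mu_mem := of_mem_piece _ rfl _
  mu_mu := by
    refine evalList_injective _ (funext fun l => ?_)
    rw [dot_of, evalList_of, contraction_bracketCochain_evalList, map_zero, Pi.zero_apply]
  dot_dot_mu := by
    rintro m n _ _ ⟨P, rfl⟩ ⟨Q, rfl⟩
    refine evalList_injective _ (funext fun l => ?_)
    simp only [dot_of, cupBracket_of, map_add, map_zsmul, Pi.add_apply, Pi.smul_apply,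
      evalList_of, contraction_contraction_evalList, doubleInsertion_bracketCochain]
  cup_mem := by
    rintro m n _ _ ⟨P, rfl⟩ ⟨Q, rfl⟩
    rw [cupBracket_of]
    exact of_mem_piece _ (add_right_comm m 1 n) _
  cup_skew := by
    rintro m n _ _ ⟨P, rfl⟩ ⟨Q, rfl⟩
    refine evalList_injective _ (funext fun l => ?_)
    simp only [cupBracket_of, map_neg, map_zsmul, Pi.neg_apply, Pi.smul_apply, evalList_of]
    exact cup_comm_evalList 𝔤 P Q l
  cup_jacobi := by
    rintro m n r _ _ _ ⟨P, rfl⟩ ⟨Q, rfl⟩ ⟨R, rfl⟩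
    refine evalList_injective _ (funext fun l => ?_)
    simp only [cupBracket_of, map_add, map_zsmul, Pi.add_apply, Pi.smul_apply, evalList_of]
    exact cup_cup_evalList 𝔤 P Q R l
  dot_cup := by
    rintro m n r _ _ _ ⟨P, rfl⟩ ⟨Q, rfl⟩ ⟨R, rfl⟩
    refine evalList_injective _ (funext fun l => ?_)
    simp only [cupBracket_of, dot_of, map_add, map_zsmul, Pi.add_apply, Pi.smul_apply,
      evalList_of]
    exact contraction_cup_evalList 𝔤 P Q R l

theorem isGradedCommutator_nrBracket (α : g →ₗ[K] g) :
    IsGradedCommutator (L := Cochains α) (piece α) (dot α) (nrBracket α) := by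
  rintro m n _ _ ⟨P, rfl⟩ ⟨Q, rfl⟩
  rw [dot_of, dot_of]
  exact bilinear_of α _ P Q

theorem isInnerDifferential_deltaHom [CharZero K] (𝔤 : MultHomLieAlgebra K g) :
    IsInnerDifferential (piece 𝔤.twist) (dot 𝔤.twist) (of 𝔤.twist 1 𝔤.bracketCochain)
      (deltaHom 𝔤) := by
  rintro n _ ⟨P, rfl⟩
  refine evalList_injective _ (funext fun l => ?_)
  rw [deltaHom, DirectSum.toModule_lof, LinearMap.comp_apply]
  simp only [dot_of, map_sub, map_zsmul, Pi.sub_apply, Pi.smul_apply, evalList_of]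
  exact differential_evalList 𝔤 P l

theorem isFrolicherNijenhuis_fnBracket [CharZero K] (𝔤 : MultHomLieAlgebra K g) :
    IsFrolicherNijenhuis (L := Cochains 𝔤.twist) (piece 𝔤.twist) (dot 𝔤.twist) (cupBracket 𝔤)
      (deltaHom 𝔤) (fnBracket 𝔤) := by
  rintro m n _ _ ⟨P, rfl⟩ ⟨Q, rfl⟩
  rw [deltaHom, DirectSum.toModule_lof, DirectSum.toModule_lof, LinearMap.comp_apply,
    LinearMap.comp_apply, dot_of, dot_of, cupBracket_of]
  exact bilinear_of 𝔤.twist _ P Q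

theorem of_mem_grading (α : g →ₗ[K] g) {s i : ℤ} {n : ℕ} (h : (n : ℤ) + 1 = i + s)
    (P : HomCochain α (n + 1)) : of α n P ∈ grading α s i := by
  intro k hk
  exact DirectSum.of_eq_of_ne _ _ _ fun hkn => hk (hkn ▸ h)

theorem mem_grading_of_mem_piece {α : g →ₗ[K] g} {s i : ℤ} {n : ℕ} (h : (n : ℤ) + 1 = i + s)
    {P : Cochains α} (hP : P ∈ piece α n) : P ∈ grading α s i := by
  obtain ⟨P, rfl⟩ := hP
  exact of_mem_grading α h P

/-- A homogeneous element for the shifted grading is zero or lies in a summand. -/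
theorem eq_zero_or_mem_piece {α : g →ₗ[K] g} {s i : ℤ} {P : Cochains α}
    (hP : P ∈ grading α s i) :
    P = 0 ∨ ∃ n : ℕ, i = (n : ℤ) + 1 - s ∧ P ∈ piece α n := by
  by_cases h : ∃ n : ℕ, (n : ℤ) + 1 = i + s
  · obtain ⟨n, hn⟩ := h
    refine Or.inr ⟨n, by omega, P n, ?_⟩
    refine DFinsupp.ext fun k => ?_
    by_cases hk : k = n
    · subst hk
      exact DirectSum.of_eq_same _ _
    · rw [hP k (by omega)]
      exact DirectSum.of_eq_of_ne _ _ _ hk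
  · push Not at h
    exact Or.inl (DFinsupp.ext fun k => hP k (h k))

theorem isInternal_grading (α : g →ₗ[K] g) (s : ℤ) : DirectSum.IsInternal (grading α s) := by
  -- The component of index `n` of a sum of homogeneous elements comes from degree `n + 1 - s`.
  have hcoe : ∀ (x : ⨁ i, grading α s i) (n : ℕ),
      DirectSum.coeAddMonoidHom (grading α s) x n = (x ((n : ℤ) + 1 - s)).1 n := by
    intro x n
    induction x using DirectSum.induction_on with
    | zero => simp
    | of i P =>
      rw [DirectSum.coeAddMonoidHom_of]
      by_cases h : (n : ℤ) + 1 - s = i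
      · subst h
        rw [DirectSum.of_eq_same]
      · rw [DirectSum.of_eq_of_ne _ _ _ h, P.2 n (by omega)]
        rfl
    | add x y hx hy =>
      rw [map_add, DirectSum.add_apply, hx, hy]
      rfl
  constructor
  · intro x y hxy
    refine DFinsupp.ext fun i => Subtype.ext (DFinsupp.ext fun n => ?_)
    by_cases h : (n : ℤ) + 1 = i + s
    · obtain rfl : (n : ℤ) + 1 - s = i := by omega
      exact (hcoe x n).symm.trans ((DFunLike.congr_fun hxy n).trans (hcoe y n))
    · exact ((x i).2 n h).trans ((y i).2 n h).symm
  · intro P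
    induction P using DirectSum.induction_on with
    | zero => exact ⟨0, map_zero _⟩
    | of n P =>
      exact ⟨DirectSum.of (fun i => grading α s i) ((n : ℤ) + 1 - s)
        ⟨of α n P, of_mem_grading α (by omega) P⟩, DirectSum.coeAddMonoidHom_of _ _ _⟩
    | add P Q hP hQ =>
      obtain ⟨x, rfl⟩ := hP
      obtain ⟨y, rfl⟩ := hQ
      exact ⟨x + y, map_add _ _ _⟩

/-- A bracket on `C^•_Hom(g, g)` that satisfies the axioms of a graded Lie algebra on the
summands, with `C^{n+1}_Hom(g, g)` in degree `n + t`, makes it a graded Lie algebra for the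
grading shifted by `1 - t`. -/
theorem isGradedLieAlgebra_grading {α : g →ₗ[K] g}
    {br : Cochains α →ₗ[K] Cochains α →ₗ[K] Cochains α} (t : ℕ)
    (hmem : ∀ {m n : ℕ} {x y : Cochains α}, x ∈ piece α m → y ∈ piece α n →
      br x y ∈ piece α (m + n + t))
    (hskew : ∀ {m n : ℕ} {x y : Cochains α}, x ∈ piece α m → y ∈ piece α n →
      br x y = -((-1 : ℤ) ^ ((m + t) * (n + t)) • br y x))
    (hjacobi : ∀ {m n r : ℕ} {x y z : Cochains α}, x ∈ piece α m → y ∈ piece α n →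
      z ∈ piece α r →
      br x (br y z) = br (br x y) z + (-1 : ℤ) ^ ((m + t) * (n + t)) • br y (br x z)) :
    IsGradedLieAlgebra (L := Cochains α) (grading α (1 - t)) br := by
  have hsign : ∀ (m n : ℕ) (P : Cochains α),
      (((m : ℤ) + 1 - (1 - t)) * ((n : ℤ) + 1 - (1 - t))).negOnePow • P =
        (-1 : ℤ) ^ ((m + t) * (n + t)) • P := by
    intro m n P
    rw [show ((m : ℤ) + 1 - (1 - t)) * ((n : ℤ) + 1 - (1 - t)) = (((m + t) * (n + t) : ℕ) : ℤ) by
      push_cast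
      ring, Int.negOnePow_def, zpow_natCast, Units.smul_def]
    simp
  refine ⟨isInternal_grading α _, ?_, ?_, ?_⟩
  · intro i j x y hx hy
    rcases eq_zero_or_mem_piece hx with rfl | ⟨m, rfl, hm⟩
    · simp
    rcases eq_zero_or_mem_piece hy with rfl | ⟨n, rfl, hn⟩
    · simp
    refine mem_grading_of_mem_piece ?_ (hmem hm hn)
    push_cast
    ring
  · intro i j x y hx hy
    rcases eq_zero_or_mem_piece hx with rfl | ⟨m, rfl, hm⟩
    · simp
    rcases eq_zero_or_mem_piece hy with rfl | ⟨n, rfl, hn⟩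
    · simp
    rw [hsign]
    exact hskew hm hn
  · intro i j k x y z hx hy hz
    rcases eq_zero_or_mem_piece hx with rfl | ⟨m, rfl, hm⟩
    · simp
    rcases eq_zero_or_mem_piece hy with rfl | ⟨n, rfl, hn⟩
    · simp
    rcases eq_zero_or_mem_piece hz with rfl | ⟨r, rfl, hr⟩
    · simp
    rw [hsign]
    exact hjacobi hm hn hr

end Cochains

end DirectSumOfCochains

end

theorem mainTheorem5 {K g : Type*} [Field K] [CharZero K] [AddCommGroup g] [Module K g]
    (𝔤 : MultHomLieAlgebra K g) :
    IsGradedLieAlgebra (L := Cochains 𝔤.twist) (Cochains.grading 𝔤.twist 0) (fnBracket 𝔤) ∧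
      IsGradedLieAlgebra (L := Cochains 𝔤.twist) (Cochains.grading 𝔤.twist 1)
        (nrBracket 𝔤.twist) ∧
      IsGradedLieHom (L := Cochains 𝔤.twist) (L' := Cochains 𝔤.twist)
        (Cochains.grading 𝔤.twist 0) (fnBracket 𝔤)
        (Cochains.grading 𝔤.twist 1) (nrBracket 𝔤.twist) (deltaHom 𝔤) := by
  have h := Cochains.isPreLieCup 𝔤
  have hnr := Cochains.isGradedCommutator_nrBracket 𝔤.twist
  have hδ := Cochains.isInnerDifferential_deltaHom 𝔤
  have hfn := Cochains.isFrolicherNijenhuis_fnBracket 𝔤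
  refine ⟨?_, ?_, ?_, ?_⟩
  · exact Cochains.isGradedLieAlgebra_grading 1 (fun hx hy => h.fn_mem hδ hfn hx hy)
      (fun hx hy => h.fn_skew hfn hx hy) (fun hx hy hz => h.fn_jacobi hnr hδ hfn hx hy hz)
  · have := Cochains.isGradedLieAlgebra_grading (br := nrBracket 𝔤.twist) 0
      (fun {m n _ _} hx hy => h.commutator_mem (m := m) (n := n) hnr hx hy)
      (fun hx hy => IsPreLieCup.commutator_skew hnr hx hy)
      (fun hx hy hz => h.commutator_jacobi hnr hx hy hz)
    simpa using this
  · intro i x hx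
    rcases Cochains.eq_zero_or_mem_piece hx with rfl | ⟨n, rfl, hn⟩
    · simp
    · refine Cochains.mem_grading_of_mem_piece ?_ (h.delta_mem hδ hn)
      push_cast
      ring
  · intro x y
    induction x using DirectSum.induction_on with
    | zero => simp
    | add x x' hx hx' => simp only [map_add, LinearMap.add_apply, hx, hx']
    | of m P =>
      induction y using DirectSum.induction_on with
      | zero => simp
      | add y y' hy hy' => simp only [map_add, hy, hy']
      | of n Q => exact h.delta_fn hnr hδ hfn ⟨P, rfl⟩ ⟨Q, rfl⟩
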